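/- Monoids are commutative with an absorbing element $0$; a module over a monoid $A$ is a pointed set $(M,*)$ with an action of $A$ such that $0\cdot m=*$ for all $m$. A map of pointed sets $f:M\to N$ is *normal* if it is injective outside $f^{-1}(*)$; a module is normal if multiplication by every $a\in A$ is a normal map. Let $\mathbb P^1$ be the projective line over $\mathbb F_1$, i.e. the monoid scheme with points $0,\infty,\eta$ obtained by gluing $U_0=\operatorname{Spec}\langle t\rangle$, $\langle t\rangle=\{0,1,t,t^2,\dots\}$, and $U_\infty=\operatorname{Spec}\langle t^{-1}\rangle$ along $\operatorname{Spec}\langle t,t^{-1}\rangle$. A sheaf of $\mathcal O_{\mathbb P^1}$-modules is *coherent* if every point has an affine open neighbourhood $U$ on which it is the sheaf $\widetilde M$ of a finitely generated $\mathcal O(U)$-module $M$. Let $Coh_n(\mathbb P^1)$ be the category of normal coherent sheaves: its objects are the coherent sheaves whose sections over every affine open form a normal module, and its morphisms are the sheaf morphisms given by normal maps on every affine open. A sequence $\emptyset\to\mathcal F\to\mathcal F'\to\mathcal F''\to\emptyset$ in $Coh_n(\mathbb P^1)$ is short exact if on every affine open the first map has trivial kernel, its image is the kernel of the second map, and the second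 map is surjective. Direct sums are wedges of pointed sets on affine opens. Let $$K_0(\mathbb P^1)=\mathbb Z[\operatorname{Iso}(Coh_n(\mathbb P^1))]\,/\,\big\langle [\mathcal F]+[\mathcal F'']-[\mathcal F'] \big\rangle,$$ with one generator of the subgroup for each short exact sequence $\emptyset\to\mathcal F\to\mathcal F'\to\mathcal F''\to\emptyset$ in $Coh_n(\mathbb P^1)$. Consider the following objects of $Coh_n(\mathbb P^1)$. * For $k\in\mathbb Z$, the line bundle $\mathcal O(k)$, glued from $\langle t\rangle$ on $U_0$ and $\langle t^{-1}\rangle$ on $U_\infty$ by the clutching map $t^i\mapsto t^{i-k}$. * For $x\in\{0,\infty\}$ and $n\ge1$, the torsion sheaf $\mathcal T_{x,n}$ supported at $x$, given by the module $\langle u\rangle/\{0,u^n,u^{n+1},\dots\}$ on $U_x$ and the zero module on the other chart, where $u=t$ if $x=0$ and $u=t^{-1}$ if $x=\infty$. * For $m\ge1$, the cyclic sheaf $\mathcal C_m$, given on both charts by the module $\{*\}\cup\{z_i: i\in\mathbb Z/m\mathbb Z\}$ with $t^{\pm1}z_i=z_{i\pm1}$, glued along the identity. **Theorem.** There is a unique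 isomorphism of abelian groups $$\Phi:K_0(\mathbb P^1)\xrightarrow{\ \sim\ }\mathbb Z\oplus\mathbb Z\oplus\bigoplus_{i\ge1}\mathbb Z$$ such that $$\Phi([\mathcal O(k)])=(1,k,0),\qquad \Phi([\mathcal T_{x,n}])=(0,n,0),\qquad \Phi([\mathcal C_m])=(0,0,e_m)$$ for all $k\in\mathbb Z$, $x\in\{0,\infty\}$ and $n,m\ge 1$, where $e_m$ is the $m$-th standard basis vector, and such that $\Phi([\mathcal F])$ is the sum of the corresponding values whenever $\mathcal F$ is a finite direct sum of sheaves $\mathcal O(k)$, $\mathcal T_{x,n}$, $\mathcal C_m$. (The three components of $\Phi$ are the rank, the degree, and the multiplicities of the cyclic sheaves $\mathcal C_m$.) -/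

import Mathlib

open CategoryTheory TopologicalSpace

namespace MonSch

/-! ## Monoid schemes

A monoid is a commutative monoid with an absorbing zero (`CommMonoidWithZero`). -/

/-- A prime ideal of a monoid with zero (an ideal contains `0`, and a prime ideal is proper). -/
@[ext] structure PrimeIdeal (A : Type) [CommMonoidWithZero A] where
  carrier : Set A
  zero_mem : (0 : A) ∈ carrier
  mul_mem : ∀ (a x : A), x ∈ carrier → a * x ∈ carrier
  one_notMem : (1 : A) ∉ carrier
  mem_or_mem : ∀ x y : A, x * y ∈ carrier → x ∈ carrier ∨ y ∈ carrier

/-- The topology of the spectrum: the sets `D(f) = {p | f ∉ p}` form a basis of open sets. -/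
instance PrimeIdeal.topology (A : Type) [CommMonoidWithZero A] : TopologicalSpace (PrimeIdeal A) :=
  TopologicalSpace.generateFrom {D | ∃ f : A, D = {p | f ∉ p.carrier}}

/-- A monoidal space: a topological space with a sheaf of commutative monoids with zero. -/
structure MonoidalSpace where
  carrier : Type
  [top : TopologicalSpace carrier]
  /-- sections of the structure sheaf -/
  O : Opens carrier → Type
  [mon : ∀ U, CommMonoidWithZero (O U)]
  res : ∀ {V U : Opens carrier}, V ≤ U → (O U →*₀ O V)
  res_refl : ∀ (U : Opens carrier) (s : O U), res (le_refl U) s = s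
  res_res : ∀ {W V U : Opens carrier} (h : W ≤ V) (h' : V ≤ U) (s : O U),
    res h (res h' s) = res (h.trans h') s
  glue : ∀ {ι : Type} (U : ι → Opens carrier) (s : ∀ i, O (U i)),
    (∀ i j, res (inf_le_left : U i ⊓ U j ≤ U i) (s i) =
      res (inf_le_right : U i ⊓ U j ≤ U j) (s j)) →
    ∃! t : O (iSup U), ∀ i, res (le_iSup U i) t = s i

attribute [instance] MonoidalSpace.top MonoidalSpace.mon

namespace MonoidalSpace

variable (X : MonoidalSpace)

/-- For `f ∈ Γ(U, O)`, the largest open subset of `U` on which `f` is invertible, that is, the set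
of points of `U` at which the germ of `f` is a unit. If `U = Spec A` this is `D(f)`. -/
def basicOpen {U : Opens X.carrier} (f : X.O U) : Opens X.carrier :=
  sSup {V | ∃ h : V ≤ U, IsUnit (X.res h f)}

theorem basicOpen_le {U : Opens X.carrier} (f : X.O U) : X.basicOpen f ≤ U :=
  sSup_le fun _ ⟨h, _⟩ => h

/-- `U` is an affine open: `(U, O|_U)` is isomorphic to `Spec A` with its structure sheaf. Then
necessarily `A = Γ(U, O)`; the isomorphism on spaces is a homeomorphism `U ≃ Spec Γ(U, O)` sending
`x` to the set of those `f` whose germ at `x` is not a unit, so that `D(f)` corresponds to the open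
set `basicOpen f`, and the sections over `D(f)` are the localization `Γ(U, O)_f`. -/
def IsAffineOpen (U : Opens X.carrier) : Prop :=
  (∃ e : U ≃ₜ PrimeIdeal (X.O U),
    ∀ (x : U) (f : X.O U), f ∉ (e x).carrier ↔ (x : X.carrier) ∈ X.basicOpen f) ∧
  ∀ f : X.O U, (Submonoid.powers f).IsLocalizationMap (X.res (X.basicOpen_le f))

/-- A monoid scheme is a monoidal space which is locally affine. -/
def IsMonoidScheme : Prop := ∀ x : X.carrier, ∃ U : Opens X.carrier, x ∈ U ∧ X.IsAffineOpen U

end MonoidalSpace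

/-! ## Modules and sheaves of modules

A module over a monoid `A` is a pointed set with an action of `A`: `MulActionWithZero A M`. -/

section Modules

variable {A M N : Type} [CommMonoidWithZero A] [Zero M] [MulActionWithZero A M] [Zero N]

/-- A map of pointed sets which is injective outside the preimage of the base point. -/
def IsNormalMap (f : M → N) : Prop := f 0 = 0 ∧ ∀ m n : M, f m ≠ 0 → f m = f n → m = n

variable (A M)

/-- A normal module: all multiplication maps are injective away from the preimage of `0`. -/
def IsNormalModule : Prop := ∀ a : A, IsNormalMap (fun m : M => a • m)

/-- A finitely generated module. -/
def IsFGModule : Prop := ∃ S : Finset M, ∀ m : M, ∃ a : A, ∃ g ∈ S, m = a • g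

end Modules

/-- A sheaf of `O_X`-modules. -/
structure OModule (X : MonoidalSpace) where
  sec : Opens X.carrier → Type
  [zero : ∀ U, Zero (sec U)]
  [act : ∀ U, MulActionWithZero (X.O U) (sec U)]
  res : ∀ {V U : Opens X.carrier}, V ≤ U → sec U → sec V
  res_zero : ∀ {V U : Opens X.carrier} (h : V ≤ U), res h 0 = 0
  res_smul : ∀ {V U : Opens X.carrier} (h : V ≤ U) (a : X.O U) (s : sec U),
    res h (a • s) = X.res h a • res h s
  res_refl : ∀ (U : Opens X.carrier) (s : sec U), res (le_refl U) s = s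
  res_res : ∀ {W V U : Opens X.carrier} (h : W ≤ V) (h' : V ≤ U) (s : sec U),
    res h (res h' s) = res (h.trans h') s
  glue : ∀ {ι : Type} (U : ι → Opens X.carrier) (s : ∀ i, sec (U i)),
    (∀ i j, res (inf_le_left : U i ⊓ U j ≤ U i) (s i) =
      res (inf_le_right : U i ⊓ U j ≤ U j) (s j)) →
    ∃! t : sec (iSup U), ∀ i, res (le_iSup U i) t = s i

attribute [instance] OModule.zero OModule.act

namespace OModule

variable {X : MonoidalSpace}

/-- For an affine open `U`: the restriction of `F` to `U` is the sheaf `M~` attached to the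
`Γ(U, O)`-module `M = Γ(U, F)`, that is, for every `f` the restriction map from `Γ(U, F)` to
sections over `D(f)` is the localization at `f`. (The element `f` is invertible on `D(f)`, so it
acts bijectively there.) -/
def IsTilde (F : OModule X) (U : Opens X.carrier) : Prop :=
  ∀ f : X.O U,
    (∀ s : F.sec (X.basicOpen f), ∃ (n : ℕ) (m : F.sec U),
      X.res (X.basicOpen_le f) (f ^ n) • s = F.res (X.basicOpen_le f) m) ∧
    (∀ m m' : F.sec U, F.res (X.basicOpen_le f) m = F.res (X.basicOpen_le f) m' →
      ∃ n : ℕ, f ^ n • m = f ^ n • m')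

/-- A coherent sheaf: near every point it is `M~` for a finitely generated module `M`. -/
def IsCoherent (F : OModule X) : Prop :=
  ∀ x : X.carrier, ∃ U : Opens X.carrier, x ∈ U ∧ X.IsAffineOpen U ∧ F.IsTilde U ∧
    IsFGModule (X.O U) (F.sec U)

/-- Normality of a (coherent) sheaf. -/
def IsNormal (F : OModule X) : Prop :=
  ∀ U : Opens X.carrier, X.IsAffineOpen U → IsNormalModule (X.O U) (F.sec U)

/-- A morphism of sheaves of `O_X`-modules. -/
@[ext] structure Hom (F G : OModule X) where
  app : ∀ U : Opens X.carrier, F.sec U → G.sec U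
  map_zero : ∀ U, app U 0 = 0
  map_smul : ∀ U (a : X.O U) (s : F.sec U), app U (a • s) = a • app U s
  naturality : ∀ {V U : Opens X.carrier} (h : V ≤ U) (s : F.sec U),
    G.res h (app U s) = app V (F.res h s)

end OModule

/-! ## The category of normal coherent sheaves and its Grothendieck group -/

/-- Objects of `Coh_n(X)`: normal coherent sheaves. -/
structure CohN (X : MonoidalSpace) where
  sheaf : OModule X
  coherent : sheaf.IsCoherent
  normal : sheaf.IsNormal

namespace CohN

variable {X : MonoidalSpace}

/-- Morphisms of `Coh_n(X)`: normal morphisms of sheaves. -/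
@[ext] structure Hom (F G : CohN X) extends OModule.Hom F.sheaf G.sheaf where
  normal : ∀ U : Opens X.carrier, X.IsAffineOpen U → IsNormalMap (app U)

instance : Category (CohN X) where
  Hom := Hom
  id F :=
    { app := fun _ s => s
      map_zero := fun _ => rfl
      map_smul := fun _ _ _ => rfl
      naturality := fun _ _ => rfl
      normal := fun _ _ => ⟨rfl, fun _ _ _ h => h⟩ }
  comp φ ψ :=
    { app := fun U s => ψ.app U (φ.app U s)
      map_zero := fun U => by rw [φ.map_zero, ψ.map_zero]
      map_smul := fun U a s => by rw [φ.map_smul, ψ.map_smul]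
      naturality := fun h s => by rw [ψ.naturality, φ.naturality]
      normal := fun U hU => by
        refine ⟨(congrArg (ψ.app U) (φ.map_zero U)).trans (ψ.map_zero U), fun m n h1 h2 => ?_⟩
        have h3 := (ψ.normal U hU).2 _ _ h1 h2
        refine (φ.normal U hU).2 _ _ (fun h0 => h1 ?_) h3
        exact (congrArg (ψ.app U) h0).trans (ψ.map_zero U) }

/-- The map on sections over `U`. -/
def app {F G : CohN X} (φ : F ⟶ G) (U : Opens X.carrier) : F.sheaf.sec U → G.sheaf.sec U :=
  (show Hom F G from φ).toHom.app U

/-- `0 → F → F' → F'' → 0` is a short exact sequence: on every affine open, the first map has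
trivial kernel, its image is the kernel of the second one, and the second one is surjective. -/
def IsShortExact {F F' F'' : CohN X} (i : F ⟶ F') (p : F' ⟶ F'') : Prop :=
  ∀ U : Opens X.carrier, X.IsAffineOpen U →
    (∀ s, app i U s = 0 → s = 0) ∧
    (∀ s, app p U s = 0 ↔ ∃ r, app i U r = s) ∧
    Function.Surjective (app p U)

/-- `F` is the direct sum of the family `G` along `i`: on every affine open, `Γ(U, F)` is the
wedge (the disjoint union with base points identified) of the `Γ(U, G j)`. -/
def IsDirectSum {J : Type} (G : J → CohN X) (F : CohN X) (i : ∀ j, G j ⟶ F) : Prop :=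
  ∀ U : Opens X.carrier, X.IsAffineOpen U →
    (∀ j, Function.Injective (app (i j) U)) ∧
    (∀ j k, j ≠ k → ∀ r r', app (i j) U r = app (i k) U r' → app (i j) U r = 0) ∧
    (∀ s, s = 0 ∨ ∃ j r, app (i j) U r = s)

end CohN

variable (X : MonoidalSpace)

/-- The set of isomorphism classes of normal coherent sheaves. -/
abbrev IsoCohN := Quotient (isIsomorphicSetoid (CohN X))

/-- The class of `F` in the free abelian group `ℤ[Iso(Coh_n(X))]`. -/
def isoClass {X : MonoidalSpace} (F : CohN X) : FreeAbelianGroup (IsoCohN X) :=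
  FreeAbelianGroup.of (Quotient.mk _ F)

/-- The subgroup generated by `[F] + [F''] - [F']` for all short exact sequences
`0 → F → F' → F'' → 0`. -/
def K0Relations : AddSubgroup (FreeAbelianGroup (IsoCohN X)) :=
  AddSubgroup.closure {z | ∃ (F F' F'' : CohN X) (i : F ⟶ F') (p : F' ⟶ F''),
    CohN.IsShortExact i p ∧ z = isoClass F + isoClass F'' - isoClass F'}

/-- The Grothendieck group of `Coh_n(X)`. -/
abbrev K0 := FreeAbelianGroup (IsoCohN X) ⧸ K0Relations X

/-- The class of a normal coherent sheaf in the Grothendieck group. -/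
def K0.cls {X : MonoidalSpace} (F : CohN X) : K0 X := QuotientAddGroup.mk (isoClass F)

/-! ## The projective line -/

/-- The two closed points of the projective line. -/
inductive ClosedPt
  | zero
  | infty
  deriving DecidableEq

/-- The points of the projective line: `0`, `∞` and the generic point `η`. -/
inductive Pt
  | closed (x : ClosedPt)
  | generic

/-- A set of points is open if it is empty or contains the generic point. -/
instance : TopologicalSpace Pt where
  IsOpen U := ∀ x ∈ U, Pt.generic ∈ U
  isOpen_univ := fun _ _ => trivial
  isOpen_inter := fun _ _ h h' x hx => ⟨h x hx.1, h' x hx.2⟩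
  isOpen_sUnion := fun _ h x ⟨t, ht, hx⟩ => ⟨t, ht, h t ht x hx⟩

/-- The chart `U_x = {x, η}`, for `x = 0, ∞`. -/
def chart (x : ClosedPt) : Opens Pt :=
  ⟨{y | y = .closed x ∨ y = .generic}, fun _ _ => Or.inr rfl⟩

/-- The stalks of the structure sheaf: the monoid `⟨t⟩ = {0, 1, t, t², …}` at `0`, the monoid
`⟨t⁻¹⟩` at `∞` (also written as a free monoid with zero on one generator), and `⟨t, t⁻¹⟩` at
the generic point. -/
def Stalk : Pt → Type
  | .closed _ => WithZero (Multiplicative ℕ)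
  | .generic => WithZero (Multiplicative ℤ)

instance : ∀ x, CommMonoidWithZero (Stalk x)
  | .closed _ => inferInstanceAs (CommMonoidWithZero (WithZero (Multiplicative ℕ)))
  | .generic => inferInstanceAs (CommMonoidWithZero (WithZero (Multiplicative ℤ)))

/-- The element `t ^ k` of `⟨t, t⁻¹⟩`. -/
def tpow (k : ℤ) : Stalk .generic := ((Multiplicative.ofAdd k : Multiplicative ℤ) : WithZero _)

/-- The power `u ^ k` of the local coordinate `u` at a closed point (`t` at `0`, `t⁻¹` at `∞`). -/
def upow (x : ClosedPt) (k : ℕ) : Stalk (.closed x) :=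
  ((Multiplicative.ofAdd k : Multiplicative ℕ) : WithZero _)

/-- The exponent of `t` in the local coordinate at a closed point. -/
def sgn : ClosedPt → ℤ
  | .zero => 1
  | .infty => -1

/-- The generization maps `⟨t⟩ → ⟨t, t⁻¹⟩` and `⟨t⁻¹⟩ → ⟨t, t⁻¹⟩` of the structure sheaf. -/
def genO : ∀ x, Stalk x →*₀ Stalk .generic
  | .closed x => WithZero.map' (AddMonoidHom.toMultiplicative
      ((AddMonoidHom.mulLeft (sgn x)).comp (Nat.castAddMonoidHom ℤ)))
  | .generic => MonoidWithZeroHom.id _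

/-- Sections of the structure sheaf of the projective line over `U`: compatible families of
elements of the stalks. -/
def P1Sec (U : Opens Pt) : Type :=
  {s : ∀ x : U, Stalk x // ∀ x y : U, genO x (s x) = genO y (s y)}

/-- Pointwise multiplication. -/
instance (U : Opens Pt) : CommMonoidWithZero (P1Sec U) where
  mul s s' := ⟨fun x => s.1 x * s'.1 x, fun x y => by rw [map_mul, map_mul, s.2 x y, s'.2 x y]⟩
  one := ⟨fun _ => 1, fun x y => by rw [map_one, map_one]⟩
  zero := ⟨fun _ => 0, fun x y => by rw [map_zero, map_zero]⟩
  mul_assoc _ _ _ := Subtype.ext (funext fun _ => mul_assoc _ _ _)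
  one_mul _ := Subtype.ext (funext fun _ => one_mul _)
  mul_one _ := Subtype.ext (funext fun _ => mul_one _)
  mul_comm _ _ := Subtype.ext (funext fun _ => mul_comm _ _)
  zero_mul _ := Subtype.ext (funext fun _ => zero_mul _)
  mul_zero _ := Subtype.ext (funext fun _ => mul_zero _)

theorem generic_mem {U : Opens Pt} {x : Pt} (h : x ∈ U) : Pt.generic ∈ U := U.2 x h

/-- The projective line over `F₁`, glued from two copies of the affine line `Spec ⟨t⟩` along
`Spec ⟨t, t⁻¹⟩`. -/
abbrev P1 : MonoidalSpace where
  carrier := Pt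
  O := P1Sec
  res h :=
    { toFun := fun s => ⟨fun x => s.1 ⟨x.1, h x.2⟩, fun x y => s.2 ⟨x.1, h x.2⟩ ⟨y.1, h y.2⟩⟩
      map_zero' := rfl
      map_one' := rfl
      map_mul' := fun _ _ => rfl }
  res_refl _ _ := rfl
  res_res _ _ _ := rfl
  glue := by
    intro ι U s hs
    have hmem : ∀ x : (iSup U : Opens Pt), ∃ i, (x : Pt) ∈ U i := fun x => Opens.mem_iSup.1 x.2
    choose c hc using hmem
    have key : ∀ (i j : ι) (x : Pt) (hi : x ∈ U i) (hj : x ∈ U j),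
        (s i).1 ⟨x, hi⟩ = (s j).1 ⟨x, hj⟩ := fun i j x hi hj =>
      congrFun (congrArg Subtype.val (hs i j)) ⟨x, hi, hj⟩
    refine ⟨⟨fun x => (s (c x)).1 ⟨x, hc x⟩, fun x y => ?_⟩, fun i => ?_, fun t ht => ?_⟩
    · rw [(s (c x)).2 ⟨x, hc x⟩ ⟨.generic, generic_mem (hc x)⟩,
        (s (c y)).2 ⟨y, hc y⟩ ⟨.generic, generic_mem (hc y)⟩,
        key (c x) (c y) .generic (generic_mem (hc x)) (generic_mem (hc y))]
    · exact Subtype.ext (funext fun x => key _ _ _ _ _)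
    · refine Subtype.ext (funext fun x => ?_)
      exact congrFun (congrArg Subtype.val (ht (c x))) ⟨x, hc x⟩

/-! ### Gluing sheaves of modules on the projective line -/

/-- Gluing data for a sheaf of modules on the projective line: a `⟨t⟩`-module `M 0`, a
`⟨t⁻¹⟩`-module `M ∞`, a `⟨t, t⁻¹⟩`-module `M η`, and equivariant maps to `M η`. -/
structure GluingData where
  M : Pt → Type
  [zero : ∀ x, Zero (M x)]
  [act : ∀ x, MulActionWithZero (Stalk x) (M x)]
  gen : ∀ x, M x → M .generic
  gen_zero : ∀ x, gen x 0 = 0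
  gen_smul : ∀ x (a : Stalk x) (m : M x), gen x (a • m) = genO x a • gen x m
  gen_generic : ∀ m, gen .generic m = m

attribute [instance] GluingData.zero GluingData.act

namespace GluingData

variable (D : GluingData)

/-- Sections over `U` of the glued sheaf: compatible families of elements of the modules. -/
def Sec (U : Opens Pt) : Type :=
  {s : ∀ x : U, D.M x // ∀ x y : U, D.gen x (s x) = D.gen y (s y)}

instance (U : Opens Pt) : Zero (D.Sec U) :=
  ⟨⟨fun _ => 0, fun x y => by rw [D.gen_zero, D.gen_zero]⟩⟩

/-- Pointwise action. -/
instance (U : Opens Pt) : MulActionWithZero (P1Sec U) (D.Sec U) where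
  smul a s := ⟨fun x => a.1 x • s.1 x, fun x y => by
    rw [D.gen_smul, D.gen_smul, a.2 x y, s.2 x y]⟩
  one_smul _ := Subtype.ext (funext fun _ => one_smul _ _)
  mul_smul _ _ _ := Subtype.ext (funext fun _ => mul_smul _ _ _)
  smul_zero _ := Subtype.ext (funext fun _ => smul_zero _)
  zero_smul _ := Subtype.ext (funext fun _ => zero_smul _ _)

/-- The sheaf of modules given by gluing data. -/
abbrev glued : OModule P1 where
  sec := fun U : Opens Pt => D.Sec U
  zero (U : Opens Pt) := inferInstanceAs (Zero (D.Sec U))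
  act (U : Opens Pt) := inferInstanceAs (MulActionWithZero (P1Sec U) (D.Sec U))
  res h s := ⟨fun x => s.1 ⟨x.1, h x.2⟩, fun x y => s.2 ⟨x.1, h x.2⟩ ⟨y.1, h y.2⟩⟩
  res_zero _ := rfl
  res_smul _ _ _ := rfl
  res_refl _ _ := rfl
  res_res _ _ _ := rfl
  glue := by
    intro ι (U : ι → Opens Pt) s hs
    have hmem : ∀ x : (iSup U : Opens Pt), ∃ i, (x : Pt) ∈ (U i : Opens Pt) := fun x => Opens.mem_iSup.1 x.2
    choose c hc using hmem
    have key : ∀ (i j : ι) (x : Pt) (hi : x ∈ (U i : Opens Pt)) (hj : x ∈ (U j : Opens Pt)),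
        (s i).1 ⟨x, hi⟩ = (s j).1 ⟨x, hj⟩ := fun i j x hi hj =>
      congrFun (congrArg Subtype.val (hs i j)) ⟨x, hi, hj⟩
    refine ⟨⟨fun x => (s (c x)).1 ⟨x, hc x⟩, fun x y => ?_⟩, fun i => ?_, fun t ht => ?_⟩
    · rw [(s (c x)).2 ⟨x, hc x⟩ ⟨.generic, generic_mem (hc x)⟩,
        (s (c y)).2 ⟨y, hc y⟩ ⟨.generic, generic_mem (hc y)⟩,
        key (c x) (c y) .generic (generic_mem (hc x)) (generic_mem (hc y))]
    · exact Subtype.ext (funext fun x => key _ _ _ _ _)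
    · refine Subtype.ext (funext fun x => ?_)
      exact congrFun (congrArg Subtype.val (ht (c x))) ⟨x, hc x⟩

end GluingData

/-! ### Affine opens of the projective line -/

theorem stalk_closed_cases {x : ClosedPt} (a : Stalk (.closed x)) : a = 0 ∨ ∃ k, a = upow x k := by
  induction a using WithZero.recZeroCoe with
  | zero => exact Or.inl rfl
  | coe a => exact Or.inr ⟨Multiplicative.toAdd a, rfl⟩

theorem stalk_generic_cases (a : Stalk .generic) : a = 0 ∨ ∃ k, a = tpow k := by
  induction a using WithZero.recZeroCoe with
  | zero => exact Or.inl rfl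
  | coe a => exact Or.inr ⟨Multiplicative.toAdd a, rfl⟩

theorem upow_add (x : ClosedPt) (j k : ℕ) : upow x (j + k) = upow x j * upow x k := rfl

theorem upow_zero (x : ClosedPt) : upow x 0 = 1 := rfl

theorem upow_pow (x : ClosedPt) (k n : ℕ) : upow x k ^ n = upow x (k * n) := by
  induction n with
  | zero => exact pow_zero _
  | succ n ih => rw [pow_succ, ih, ← upow_add]; rfl

theorem tpow_add (j k : ℤ) : tpow (j + k) = tpow j * tpow k := rfl

theorem upow_ne_zero (x : ClosedPt) (k : ℕ) : upow x k ≠ 0 := WithZero.coe_ne_zero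

theorem upow_injective (x : ClosedPt) : Function.Injective (upow x) := fun _ _ h =>
  Multiplicative.ofAdd.injective (WithZero.coe_injective h)

theorem tpow_injective : Function.Injective tpow := fun _ _ h =>
  Multiplicative.ofAdd.injective (WithZero.coe_injective h)

theorem tpow_ne_zero (k : ℤ) : tpow k ≠ 0 := WithZero.coe_ne_zero

theorem genO_upow (x : ClosedPt) (k : ℕ) : genO (.closed x) (upow x k) = tpow (sgn x * k) := rfl

theorem genO_generic (a : Stalk .generic) : genO .generic a = a := rfl

theorem sgn_mul_self (x : ClosedPt) : sgn x * sgn x = 1 := by cases x <;> rfl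

theorem genO_injective : ∀ x, Function.Injective (genO x)
  | .generic => fun _ _ h => h
  | .closed x => fun a b h => by
    rcases stalk_closed_cases a with rfl | ⟨j, rfl⟩ <;>
      rcases stalk_closed_cases b with rfl | ⟨k, rfl⟩
    · rfl
    · rw [map_zero, genO_upow] at h; exact absurd h.symm (tpow_ne_zero _)
    · rw [map_zero, genO_upow] at h; exact absurd h (tpow_ne_zero _)
    · rw [genO_upow, genO_upow] at h
      have h1 := tpow_injective h
      have h2 : (j : ℤ) = k := by cases x <;> simp [sgn] at h1 <;> exact_mod_cast h1
      rw [Nat.cast_injective h2]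

instance stalk_nontrivial : ∀ x, Nontrivial (Stalk x)
  | .closed x => ⟨⟨upow x 0, 0, upow_ne_zero x 0⟩⟩
  | .generic => ⟨⟨tpow 0, 0, tpow_ne_zero 0⟩⟩

theorem isUnit_tpow (k : ℤ) : IsUnit (tpow k) :=
  IsUnit.of_mul_eq_one (tpow (-k)) (by rw [← tpow_add, add_neg_cancel]; rfl)

theorem isUnit_upow {x : ClosedPt} {k : ℕ} : IsUnit (upow x k) ↔ k = 0 := by
  constructor
  · intro h
    obtain ⟨b, hb⟩ := h.exists_right_inv
    rcases stalk_closed_cases b with rfl | ⟨j, rfl⟩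
    · rw [mul_zero] at hb; exact absurd hb zero_ne_one
    · rw [← upow_add, ← upow_zero x] at hb
      have := upow_injective x hb
      omega
  · rintro rfl; exact isUnit_one

theorem p1sec_isUnit {U : Opens Pt} (f : P1Sec U) : IsUnit f ↔ ∀ x, IsUnit (f.1 x) := by
  constructor
  · intro h x
    obtain ⟨g, hg⟩ := h.exists_right_inv
    exact IsUnit.of_mul_eq_one (g.1 x) (congrFun (congrArg Subtype.val hg) x)
  · intro h
    choose b hb using fun x => (h x).exists_right_inv
    refine IsUnit.of_mul_eq_one (⟨b, fun x y => ?_⟩ : P1Sec U) (Subtype.ext (funext hb))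
    have hx : genO x (f.1 x) * genO x (b x) = 1 := by rw [← map_mul, hb, map_one]
    have hy : genO x (f.1 x) * genO y (b y) = 1 := by rw [f.2 x y, ← map_mul, hb, map_one]
    exact ((h x).map (genO x)).mul_left_cancel (hx.trans hy.symm)

theorem mem_basicOpen {U : Opens Pt} (f : P1Sec U) (y : U) :
    (y : Pt) ∈ P1.basicOpen (U := U) f ↔ IsUnit (f.1 y) := by
  constructor
  · intro h
    obtain ⟨V, ⟨hV, hu⟩, hy⟩ := Opens.mem_sSup.1 h
    exact (p1sec_isUnit _).1 hu ⟨y, hy⟩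
  · intro h
    refine Opens.mem_sSup.2 ⟨⟨{z | z = y ∨ z = .generic}, fun _ _ => Or.inr rfl⟩, ⟨?_, ?_⟩,
      Or.inl rfl⟩
    · rintro z (rfl | rfl)
      · exact y.2
      · exact generic_mem y.2
    · refine (p1sec_isUnit _).2 ?_
      rintro ⟨z, hz⟩
      rcases hz with rfl | rfl
      · exact h
      · have := h.map (genO y)
        rw [f.2 y ⟨.generic, generic_mem y.2⟩] at this
        exact this

namespace GluingData

variable (D : GluingData)

/-- The values of the section over a chart determined by an element of the module at the closed
point. -/
def chartFun {x : ClosedPt} (m : D.M (.closed x)) : ∀ y : Pt, y ∈ chart x → D.M y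
  | .closed z, h =>
    have e : Pt.closed x = Pt.closed z := by
      rcases h with h | h
      · exact h.symm
      · cases h
    cast (congrArg D.M e) m
  | .generic, _ => D.gen _ m

/-- The section over a chart determined by an element of the module at the closed point. -/
def chartSec {x : ClosedPt} (m : D.M (.closed x)) : D.Sec (chart x) :=
  ⟨fun y => D.chartFun m y.1 y.2, by
    have key : ∀ y : chart x, D.gen y (D.chartFun m y.1 y.2) = D.gen _ m := by
      rintro ⟨y, hy⟩
      rcases hy with rfl | rfl
      · rfl
      · exact D.gen_generic _
    intro y z
    exact (key y).trans (key z).symm⟩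

theorem closed_mem (x : ClosedPt) : Pt.closed x ∈ chart x := Or.inl rfl

theorem generic_mem_chart (x : ClosedPt) : Pt.generic ∈ chart x := Or.inr rfl

theorem chartSec_closed {x : ClosedPt} (m : D.M (.closed x)) :
    (D.chartSec m).1 ⟨.closed x, closed_mem x⟩ = m := rfl

theorem chartSec_generic {x : ClosedPt} (m : D.M (.closed x)) :
    (D.chartSec m).1 ⟨.generic, generic_mem_chart x⟩ = D.gen _ m := rfl

theorem sec_generic {U : Opens Pt} (s : D.Sec U) (y : U) (h : Pt.generic ∈ U) :
    s.1 ⟨.generic, h⟩ = D.gen y (s.1 y) := by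
  rw [← D.gen_generic (s.1 ⟨.generic, h⟩)]
  exact s.2 ⟨.generic, h⟩ y

theorem chart_ext {x : ClosedPt} {s s' : D.Sec (chart x)}
    (h : s.1 ⟨.closed x, closed_mem x⟩ = s'.1 ⟨.closed x, closed_mem x⟩) : s = s' := by
  refine Subtype.ext (funext ?_)
  rintro ⟨y, hy⟩
  rcases hy with rfl | rfl
  · exact h
  · have h1 := D.sec_generic s ⟨.closed x, closed_mem x⟩ (generic_mem_chart x)
    have h2 := D.sec_generic s' ⟨.closed x, closed_mem x⟩ (generic_mem_chart x)
    rw [h, ← h2] at h1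
    exact h1

/-- Conditions for the sheaf given by gluing data to be coherent and normal: the modules at the
closed points are finitely generated and normal, and the maps to the module at the generic point
are localizations. -/
structure IsGood : Prop where
  fg : ∀ x : ClosedPt, IsFGModule (Stalk (.closed x)) (D.M (.closed x))
  normal : ∀ x : Pt, IsNormalModule (Stalk x) (D.M x)
  loc_surj : ∀ (x : ClosedPt) (e : D.M .generic), ∃ (k : ℕ) (m : D.M (.closed x)),
    genO _ (upow x k) • e = D.gen _ m
  loc_inj : ∀ (x : ClosedPt) (m m' : D.M (.closed x)), D.gen _ m = D.gen _ m' →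
    ∃ k : ℕ, upow x k • m = upow x k • m'

variable {D}

theorem sec_subsingleton {U : Opens Pt} (hU : ∀ y, y ∉ U) (s s' : D.Sec U) : s = s' :=
  Subtype.ext (funext fun y => absurd y.2 (hU y))

theorem pow_val {U : Opens Pt} (f : P1Sec U) (n : ℕ) (y : U) : (f ^ n).1 y = f.1 y ^ n := by
  induction n with
  | zero => rw [pow_zero, pow_zero]; rfl
  | succ n ih =>
    rw [pow_succ, pow_succ, ← ih]
    rfl

theorem isTilde (h : ∀ (x : ClosedPt) (e : D.M .generic), ∃ (k : ℕ) (m : D.M (.closed x)),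
      genO _ (upow x k) • e = D.gen _ m)
    (h' : ∀ (x : ClosedPt) (m m' : D.M (.closed x)), D.gen _ m = D.gen _ m' →
      ∃ k : ℕ, upow x k • m = upow x k • m') (x : ClosedPt) :
    D.glued.IsTilde (chart x) := by
  intro (f : P1Sec (chart x))
  set c : chart x := ⟨.closed x, closed_mem x⟩ with hc
  set g : chart x := ⟨.generic, generic_mem_chart x⟩ with hg
  have hfg : f.1 g = genO _ (f.1 c) := f.2 g c
  have hle := P1.basicOpen_le (U := chart x) f
  rcases stalk_closed_cases (f.1 c) with h0 | ⟨k, hk⟩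
  · have hempty : ∀ y, y ∉ P1.basicOpen (U := chart x) f := by
      intro y hy
      have h1 := (mem_basicOpen f ⟨y, hle hy⟩).1 hy
      have h2 := h1.map (genO _)
      rw [f.2 ⟨y, hle hy⟩ c, h0, map_zero] at h2
      exact not_isUnit_zero h2
    refine ⟨fun s => ⟨0, 0, sec_subsingleton hempty _ _⟩, fun m m' _ => ⟨1, ?_⟩⟩
    refine D.chart_ext ?_
    change (f ^ 1).1 c • m.1 c = (f ^ 1).1 c • m'.1 c
    rw [pow_val, pow_one, h0, zero_smul, zero_smul]
  · have hgm : (g : Pt) ∈ P1.basicOpen (U := chart x) f := by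
      rw [mem_basicOpen, hfg, hk, genO_upow]
      exact isUnit_tpow _
    by_cases hk0 : k = 0
    · subst hk0
      have hcm : (c : Pt) ∈ P1.basicOpen (U := chart x) f := by
        rw [mem_basicOpen, hk]
        exact isUnit_one
      have hle' : chart x ≤ P1.basicOpen (U := chart x) f := by
        rintro y (rfl | rfl)
        · exact hcm
        · exact hgm
      refine ⟨fun s => ⟨0, D.glued.res hle' s, ?_⟩, fun m m' hm => ⟨0, ?_⟩⟩
      · rw [pow_zero, map_one, one_smul]
        rfl
      · refine D.chart_ext ?_
        change (f ^ 0).1 c • m.1 c = (f ^ 0).1 c • m'.1 c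
        have := congrFun (congrArg Subtype.val hm) ⟨c, hcm⟩
        exact congrArg _ this
    · have hcm : (c : Pt) ∉ P1.basicOpen (U := chart x) f := by
        rw [mem_basicOpen, hk, isUnit_upow]
        exact hk0
      have honly : ∀ y ∈ P1.basicOpen (U := chart x) f, y = .generic := by
        intro y hy
        rcases hle hy with rfl | rfl
        · exact absurd hy hcm
        · rfl
      refine ⟨fun s => ?_, fun m m' hm => ?_⟩
      · obtain ⟨j, m, hm⟩ := h x (s.1 ⟨.generic, hgm⟩)
        have hkj : k * j = (k * j - j) + j := by
          have : j ≤ k * j := Nat.le_mul_of_pos_left j (by omega)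
          omega
        refine ⟨j, D.chartSec (upow x (k * j - j) • m), Subtype.ext (funext ?_)⟩
        rintro ⟨y, hy⟩
        obtain rfl := honly y hy
        change (f ^ j).1 g • s.1 ⟨.generic, hgm⟩ = D.gen _ (upow x (k * j - j) • m)
        rw [pow_val, hfg, hk, ← map_pow, upow_pow, hkj, upow_add, map_mul, mul_smul, hm,
          ← D.gen_smul]
        congr 3
        omega
      · have h1 : m.1 g = m'.1 g := congrFun (congrArg Subtype.val hm) ⟨.generic, hgm⟩
        rw [D.sec_generic m c, D.sec_generic m' c] at h1
        obtain ⟨j, hj⟩ := h' x _ _ h1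
        refine ⟨j, D.chart_ext ?_⟩
        change (f ^ j).1 c • m.1 c = (f ^ j).1 c • m'.1 c
        have hkj : k * j = (k * j - j) + j := by
          have : j ≤ k * j := Nat.le_mul_of_pos_left j (by omega)
          omega
        rw [pow_val, hk, upow_pow, hkj, upow_add, mul_smul, mul_smul]
        exact congrArg _ hj

end GluingData

open GluingData

theorem stalk_loc_surj (x : ClosedPt) (j : ℤ) (e : Stalk .generic) :
    ∃ (k : ℕ) (m : Stalk (.closed x)), genO _ (upow x k) * e = tpow j * genO _ m := by
  rcases stalk_generic_cases e with rfl | ⟨i, rfl⟩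
  · exact ⟨0, 0, by rw [map_zero, mul_zero, mul_zero]⟩
  · refine ⟨(i - j).natAbs, upow x ((i - j).natAbs + (sgn x * (i - j))).toNat, ?_⟩
    rw [genO_upow, genO_upow, ← tpow_add, ← tpow_add]
    congr 1
    cases x <;> simp only [sgn] <;> omega

/-- Gluing data for the structure sheaf. -/
abbrev structureData : GluingData where
  M := Stalk
  gen x := genO x
  gen_zero _ := map_zero _
  gen_smul _ _ _ := map_mul _ _ _
  gen_generic _ := rfl

theorem isTilde_structure (x : ClosedPt) : structureData.glued.IsTilde (chart x) := by
  refine isTilde (fun x e => ?_) (fun x m m' h => ⟨0, congrArg _ (genO_injective _ h)⟩) x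
  obtain ⟨k, m, h⟩ := stalk_loc_surj x 0 e
  exact ⟨k, m, h.trans (one_mul _)⟩

theorem isAffineOpen_chart (x : ClosedPt) : P1.IsAffineOpen (chart x) := by
  constructor
  · let e : chart x → PrimeIdeal (P1Sec (chart x)) := fun y =>
      { carrier := {f | ¬ IsUnit (f.1 y)}
        zero_mem := not_isUnit_zero
        mul_mem := fun a f hf h => hf (isUnit_of_mul_isUnit_right h)
        one_notMem := fun h => h isUnit_one
        mem_or_mem := fun a b h => by
          by_contra! h'
          exact h ((not_not.1 h'.1).mul (not_not.1 h'.2)) }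
    have he : ∀ (y : chart x) (f : P1Sec (chart x)), f ∈ (e y).carrier ↔ ¬ IsUnit (f.1 y) :=
      fun _ _ => Iff.rfl
    set c : chart x := ⟨.closed x, closed_mem x⟩ with hc
    set g : chart x := ⟨.generic, generic_mem_chart x⟩ with hg
    have hcases : ∀ y : chart x, y = c ∨ y = g := by
      rintro ⟨y, rfl | rfl⟩
      · exact Or.inl rfl
      · exact Or.inr rfl
    let u : P1Sec (chart x) := structureData.chartSec (x := x) (upow x 1)
    have huc : u ∈ (e c).carrier := fun h => one_ne_zero (isUnit_upow.1 h)
    have hug : u ∉ (e g).carrier := fun h => h (isUnit_tpow _)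
    have hval : ∀ f : P1Sec (chart x), f.1 g = genO _ (f.1 c) := fun f => f.2 g c
    have hext : ∀ f f' : P1Sec (chart x), f.1 c = f'.1 c → f = f' :=
      fun f f' h => structureData.chart_ext h
    have hinj : Function.Injective e := by
      intro y z h
      rcases hcases y with rfl | rfl <;> rcases hcases z with rfl | rfl
      · rfl
      · rw [h] at huc
        exact absurd huc hug
      · rw [← h] at huc
        exact absurd huc hug
      · rfl
    have hmemc : ∀ f : P1Sec (chart x), f ∈ (e c).carrier ↔ ∃ a, f = a * u := by
      intro f
      rw [he]
      constructor
      · intro h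
        rcases stalk_closed_cases (f.1 c) with h0 | ⟨k, hk⟩
        · exact ⟨0, hext _ _ (h0.trans (zero_mul (u.1 c)).symm)⟩
        · rw [hk, isUnit_upow] at h
          refine ⟨structureData.chartSec (x := x) (upow x (k - 1)), hext _ _ (hk.trans ?_)⟩
          change upow x k = upow x (k - 1) * upow x 1
          rw [← upow_add]
          congr 1
          omega
      · rintro ⟨a, rfl⟩ h
        exact huc (isUnit_of_mul_isUnit_right (x := a.1 c) h)
    have hmemg : ∀ f : P1Sec (chart x), f ∈ (e g).carrier ↔ f = 0 := by
      intro f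
      rw [he, hval]
      rcases stalk_closed_cases (f.1 c) with h0 | ⟨k, hk⟩
      · rw [h0, map_zero]
        exact ⟨fun _ => hext _ _ h0, fun _ => not_isUnit_zero⟩
      · rw [hk, genO_upow]
        refine ⟨fun h => absurd (isUnit_tpow _) h, fun h => ?_⟩
        rw [h] at hk
        exact absurd hk.symm (upow_ne_zero _ _)
    have hpow : ∀ f : P1Sec (chart x), f ≠ 0 → ∃ k : ℕ, f = u ^ k := by
      intro f h
      rcases stalk_closed_cases (f.1 c) with h0 | ⟨k, hk⟩
      · exact absurd (hext _ _ h0) h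
      · refine ⟨k, hext _ _ (hk.trans ?_)⟩
        rw [pow_val]
        change upow x k = upow x 1 ^ k
        rw [upow_pow, one_mul]
    have hsurj : Function.Surjective e := by
      intro p
      by_cases hu : u ∈ p.carrier
      · refine ⟨c, PrimeIdeal.ext (Set.ext fun f => ?_)⟩
        rw [hmemc]
        refine ⟨?_, fun h => ?_⟩
        · rintro ⟨a, rfl⟩
          exact p.mul_mem _ _ hu
        · by_cases hf : f = 0
          · exact ⟨0, by rw [hf, zero_mul]⟩
          · obtain ⟨k, rfl⟩ := hpow f hf
            cases k with
            | zero =>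
              rw [pow_zero] at h
              exact absurd h p.one_notMem
            | succ k => exact ⟨u ^ k, pow_succ _ _⟩
      · refine ⟨g, PrimeIdeal.ext (Set.ext fun f => ?_)⟩
        rw [hmemg]
        refine ⟨?_, fun h => ?_⟩
        · rintro rfl
          exact p.zero_mem
        · by_contra hf
          obtain ⟨k, rfl⟩ := hpow f hf
          induction k with
          | zero =>
            rw [pow_zero] at h
            exact p.one_notMem h
          | succ k ih =>
            rw [pow_succ] at h
            rcases p.mem_or_mem _ _ h with h | h
            · refine ih h fun h0 => hf ?_
              rw [pow_succ, h0, zero_mul]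
            · exact hu h
    have hcont : Continuous e := by
      refine continuous_generateFrom_iff.2 ?_
      rintro _ ⟨f, rfl⟩
      have : e ⁻¹' {p | f ∉ p.carrier} =
          Subtype.val ⁻¹' (P1.basicOpen (U := chart x) f : Set Pt) := by
        ext y
        exact not_not.trans (mem_basicOpen f y).symm
      rw [this]
      exact (P1.basicOpen (U := chart x) f).isOpen.preimage continuous_subtype_val
    have hopen : IsOpenMap e := by
      intro V hV
      obtain ⟨W, hW, rfl⟩ := isOpen_induced_iff.1 hV
      by_cases hcW : (c : Pt) ∈ W
      · have : e '' (Subtype.val ⁻¹' W) = Set.univ := by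
          refine Set.eq_univ_of_forall fun p => ?_
          obtain ⟨y, rfl⟩ := hsurj p
          refine ⟨y, ?_, rfl⟩
          rcases hcases y with rfl | rfl
          · exact hcW
          · exact hW _ hcW
        rw [this]
        exact isOpen_univ
      · by_cases hgW : (g : Pt) ∈ W
        · have : e '' (Subtype.val ⁻¹' W) = {p | u ∉ p.carrier} := by
            ext p
            obtain ⟨y, rfl⟩ := hsurj p
            rw [hinj.mem_set_image]
            rcases hcases y with rfl | rfl
            · exact ⟨fun h => absurd h hcW, fun h => absurd huc h⟩
            · exact ⟨fun _ => hug, fun _ => hgW⟩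
          rw [this]
          exact TopologicalSpace.isOpen_generateFrom_of_mem ⟨u, rfl⟩
        · have : e '' (Subtype.val ⁻¹' W) = ∅ := by
            rw [Set.image_eq_empty]
            ext y
            rcases hcases y with rfl | rfl
            · exact ⟨fun h => absurd h hcW, fun h => h.elim⟩
            · exact ⟨fun h => absurd h hgW, fun h => h.elim⟩
          rw [this]
          exact isOpen_empty
    exact ⟨(Equiv.ofBijective e ⟨hinj, hsurj⟩).toHomeomorphOfContinuousOpen hcont hopen,
      fun y f => not_not.trans (mem_basicOpen f y).symm⟩
  · intro f
    have h := isTilde_structure x f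
    refine ⟨?_, fun z => ?_, fun {m m'} hm => ?_⟩
    · rintro ⟨_, n, rfl⟩
      refine (p1sec_isUnit _).2 fun y => ?_
      have h1 := (mem_basicOpen f ⟨y, P1.basicOpen_le f y.2⟩).1 y.2
      have h2 := h1.pow n
      rw [← pow_val] at h2
      exact h2
    · obtain ⟨n, m, hm⟩ := h.1 z
      exact ⟨(m, ⟨f ^ n, n, rfl⟩), (mul_comm _ _).trans hm⟩
    · obtain ⟨n, hn⟩ := h.2 m m' hm
      exact ⟨⟨f ^ n, n, rfl⟩, hn⟩

theorem mem_some_chart : ∀ y : Pt, ∃ x, y ∈ chart x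
  | .closed x => ⟨x, closed_mem x⟩
  | .generic => ⟨.zero, generic_mem_chart _⟩

theorem isMonoidScheme_P1 : P1.IsMonoidScheme := fun y =>
  let ⟨x, hx⟩ := mem_some_chart y
  ⟨chart x, hx, isAffineOpen_chart x⟩

/-- A nonempty affine open has a closed point, which lies in no smaller open subset. -/
theorem exists_closed_point {X : MonoidalSpace} {U : Opens X.carrier} (hU : X.IsAffineOpen U)
    (h01 : (1 : X.O U) ≠ 0) : ∃ x : U, ∀ V : Opens X.carrier, (x : X.carrier) ∈ V → U ≤ V := by
  obtain ⟨⟨e, -⟩, -⟩ := hU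
  let p : PrimeIdeal (X.O U) :=
    { carrier := {f | ¬ IsUnit f}
      zero_mem := fun h => by
        obtain ⟨b, hb⟩ := h.exists_right_inv
        rw [zero_mul] at hb
        exact h01 hb.symm
      mul_mem := fun a f hf h => hf (isUnit_of_mul_isUnit_right h)
      one_notMem := fun h => h isUnit_one
      mem_or_mem := fun a b h => by
        by_contra! h'
        exact h ((not_not.1 h'.1).mul (not_not.1 h'.2)) }
  have key : ∀ W : Set (PrimeIdeal (X.O U)), IsOpen W → p ∈ W → W = Set.univ := by
    intro W hW
    induction hW with
    | basic W hW =>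
      obtain ⟨f, rfl⟩ := hW
      intro hf
      refine Set.eq_univ_of_forall fun q hq => q.one_notMem ?_
      obtain ⟨b, hb⟩ := (not_not.1 hf : IsUnit f).exists_left_inv
      rw [← hb]
      exact q.mul_mem _ _ hq
    | univ => exact fun _ => rfl
    | inter W W' _ _ ih ih' => exact fun h => by rw [ih h.1, ih' h.2, Set.univ_inter]
    | sUnion S _ ih =>
      rintro ⟨W, hW, hp⟩
      exact Set.univ_subset_iff.1 ((ih W hW hp).symm.subset.trans (Set.subset_sUnion_of_mem hW))
  refine ⟨e.symm p, fun V hV y hy => ?_⟩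
  have h1 := key (e.symm ⁻¹' (Subtype.val ⁻¹' (V : Set X.carrier)))
    ((V.isOpen.preimage continuous_subtype_val).preimage e.symm.continuous) hV
  have h2 : e ⟨y, hy⟩ ∈ e.symm ⁻¹' (Subtype.val ⁻¹' (V : Set X.carrier)) := h1 ▸ trivial
  rw [Set.mem_preimage, e.symm_apply_apply] at h2
  exact h2

namespace GluingData

variable {D : GluingData}

theorem isCoherent (hD : D.IsGood) : D.glued.IsCoherent := by
  intro y
  obtain ⟨x, hx⟩ := mem_some_chart y
  refine ⟨chart x, hx, isAffineOpen_chart x, isTilde hD.loc_surj hD.loc_inj x, ?_⟩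
  classical
  obtain ⟨S, hS⟩ := hD.fg x
  refine ⟨S.image D.chartSec, fun s => ?_⟩
  obtain ⟨a, g, hg, h⟩ := hS (s.1 ⟨.closed x, closed_mem x⟩)
  exact ⟨structureData.chartSec (x := x) a, D.chartSec g, Finset.mem_image_of_mem _ hg,
    D.chart_ext h⟩

theorem isNormal (hD : D.IsGood) : D.glued.IsNormal := by
  intro U hU a
  refine ⟨(D.glued.act U).smul_zero a, fun s s' h0 h => ?_⟩
  by_cases hne : ∃ y, y ∈ U
  · obtain ⟨y, hy⟩ := hne
    have h01 : (1 : P1.O U) ≠ 0 := fun h1 =>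
      one_ne_zero (α := Stalk y) (congrFun (congrArg Subtype.val h1) ⟨y, hy⟩)
    obtain ⟨x, hx⟩ := exists_closed_point hU h01
    have hdet : ∀ r r' : D.Sec U, r.1 x = r'.1 x → r = r' := by
      intro r r' hr
      have hgen : ∀ z : U, (z : Pt) = x ∨ (z : Pt) = .generic := fun z =>
        hx ⟨{z | z = x ∨ z = .generic}, fun _ _ => Or.inr rfl⟩ (Or.inl rfl) z.2
      refine Subtype.ext (funext ?_)
      rintro ⟨z, hz⟩
      rcases hgen ⟨z, hz⟩ with rfl | rfl
      · exact hr
      · have h1 := D.sec_generic r x hz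
        have h2 := D.sec_generic r' x hz
        rw [hr, ← h2] at h1
        exact h1
    refine hdet s s' ((hD.normal x (a.1 x)).2 _ _ (fun h1 => h0 (hdet _ _ h1)) ?_)
    exact congrFun (congrArg Subtype.val h) x
  · exact sec_subsingleton (fun y hy => hne ⟨y, hy⟩) _ _

/-- The normal coherent sheaf given by gluing data. -/
def toCohN (D : GluingData) (hD : D.IsGood) : CohN P1 := ⟨D.glued, isCoherent hD, isNormal hD⟩

end GluingData

/-! ### The indecomposable sheaves -/

/-- Gluing data for the line bundle `O(k)`: the modules are `⟨t⟩`, `⟨t⁻¹⟩` and `⟨t, t⁻¹⟩`, and the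
clutching map from the restriction of the first one to the restriction of the second one is
`t ^ i ↦ t ^ (i - k)`. -/
abbrev lineBundleData (k : ℤ) : GluingData where
  M := Stalk
  gen x m := match x with
    | .closed .zero => tpow (-k) * genO _ m
    | .closed .infty => genO _ m
    | .generic => m
  gen_zero x := by
    rcases x with (_ | _) | _
    · exact (congrArg _ (map_zero _)).trans (mul_zero _)
    · exact map_zero _
    · rfl
  gen_smul x a m := by
    rcases x with (_ | _) | _
    · exact (congrArg _ (map_mul _ _ _)).trans (mul_left_comm _ _ _)
    · exact map_mul _ _ _
    · rfl
  gen_generic _ := rfl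

/-- The maps of the gluing data of a line bundle are `a ↦ t ^ j · a` for some `j`. -/
theorem lineBundleData_gen (k : ℤ) (x : ClosedPt) :
    ∃ j : ℤ, ∀ a : Stalk (.closed x), (lineBundleData k).gen (.closed x) a = tpow j * genO _ a := by
  cases x
  · exact ⟨-k, fun _ => rfl⟩
  · exact ⟨0, fun a => (one_mul (genO _ a)).symm⟩

theorem stalk_mul_cancel {x : Pt} {a b c : Stalk x} (h0 : a * b ≠ 0) (h : a * b = a * c) :
    b = c := by
  rcases stalk_generic_cases (genO x a) with h1 | ⟨j, hj⟩
  · exact absurd (by rw [genO_injective _ (h1.trans (map_zero _).symm), zero_mul]) h0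
  · refine genO_injective _ ((isUnit_tpow j).mul_left_cancel ?_)
    rw [← hj, ← map_mul, h, map_mul]

theorem lineBundleData_isGood (k : ℤ) : (lineBundleData k).IsGood where
  fg x := ⟨{(1 : Stalk (.closed x))}, fun m => ⟨m, 1, Finset.mem_singleton_self _, (mul_one m).symm⟩⟩
  normal x a := ⟨mul_zero a, fun _ _ => stalk_mul_cancel⟩
  loc_surj x e := by
    obtain ⟨j, hj⟩ := lineBundleData_gen k x
    obtain ⟨i, m, h⟩ := stalk_loc_surj x j e
    exact ⟨i, m, h.trans (hj m).symm⟩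
  loc_inj x m m' h := by
    obtain ⟨j, hj⟩ := lineBundleData_gen k x
    exact ⟨0, congrArg _ (genO_injective _
      ((isUnit_tpow j).mul_left_cancel ((hj m).symm.trans (h.trans (hj m')))))⟩

/-- The line bundle `O(k)`. -/
def lineBundle (k : ℤ) : CohN P1 := (lineBundleData k).toCohN (lineBundleData_isGood k)

/-- The `⟨t⟩`-module (or `⟨t⁻¹⟩`-module) `T_n = ⟨t⟩ / {0, t ^ n, t ^ (n + 1), …}`, with nonzero
elements `1, t, …, t ^ (n - 1)`; here `i : Fin n` stands for `t ^ i`. -/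
def TorMod (n : ℕ) : Type := Option (Fin n)

namespace TorMod

variable {n : ℕ}

instance : Zero (TorMod n) := ⟨none⟩

/-- The class of `t ^ i`, which is zero for `i ≥ n`. -/
def mk (n i : ℕ) : TorMod n := if h : i < n then some ⟨i, h⟩ else none

/-- Multiplication by `t ^ k`. -/
def shift (k : ℕ) : TorMod n → TorMod n
  | none => 0
  | some i => mk n (k + i)

theorem mk_of_lt {i : ℕ} (h : i < n) : mk n i = some ⟨i, h⟩ := dif_pos h

theorem mk_of_le {i : ℕ} (h : n ≤ i) : mk n i = 0 := dif_neg (by omega)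

theorem cases (m : TorMod n) : m = 0 ∨ ∃ i, i < n ∧ m = mk n i := by
  rcases m with _ | i
  · exact Or.inl rfl
  · exact Or.inr ⟨i, i.2, (mk_of_lt i.2).symm⟩

theorem mk_eq_zero (i : ℕ) : mk n i = 0 ↔ n ≤ i := by
  refine ⟨fun h => ?_, mk_of_le⟩
  by_contra h'
  have h1 := (mk_of_lt (n := n) (i := i) (by omega)).symm.trans h
  exact Option.some_ne_none _ h1

theorem mk_inj {i j : ℕ} (hi : i < n) (h : mk n i = mk n j) : i = j := by
  have hj : j < n := by
    by_contra hj
    have := (mk_eq_zero i).1 (h.trans (mk_of_le (by omega)))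
    omega
  have h1 := (mk_of_lt hi).symm.trans (h.trans (mk_of_lt hj))
  exact congrArg Fin.val (Option.some_injective _ h1)

theorem shift_zero (k : ℕ) : shift k (0 : TorMod n) = 0 := rfl

theorem shift_mk (k i : ℕ) : shift k (mk n i) = mk n (k + i) := by
  by_cases h : i < n
  · exact congrArg (shift k) (mk_of_lt h)
  · rw [(mk_eq_zero i).2 (by omega), shift_zero, (mk_eq_zero _).2 (by omega)]

instance (x : ClosedPt) : MulActionWithZero (Stalk (.closed x)) (TorMod n) where
  smul a m := match a with
    | none => 0
    | some k => shift (Multiplicative.toAdd k) m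
  one_smul m := by
    change shift 0 m = m
    rcases cases m with rfl | ⟨i, _, rfl⟩
    · rfl
    · rw [shift_mk, zero_add]
  mul_smul a b m := by
    rcases a with _ | a
    · rfl
    rcases b with _ | b
    · rfl
    change shift (Multiplicative.toAdd a + Multiplicative.toAdd b) m =
      shift (Multiplicative.toAdd a) (shift (Multiplicative.toAdd b) m)
    rcases cases m with rfl | ⟨i, _, rfl⟩
    · rfl
    · rw [shift_mk, shift_mk, shift_mk, add_assoc]
  smul_zero a := by rcases a with _ | a <;> rfl
  zero_smul _ := rfl

theorem upow_smul (x : ClosedPt) (k i : ℕ) : upow x k • mk n i = mk n (k + i) := shift_mk k i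

end TorMod

/-- Gluing data for the torsion sheaf with module `T_{l 0}` at `0`, module `T_{l ∞}` at `∞`, and
generic module zero. -/
def torsionData (l : ClosedPt → ℕ) : GluingData where
  M x := match x with
    | .closed x => TorMod (l x)
    | .generic => PUnit
  zero x := match x with
    | .closed x => inferInstanceAs (Zero (TorMod (l x)))
    | .generic => inferInstanceAs (Zero PUnit)
  act x := match x with
    | .closed x => inferInstanceAs (MulActionWithZero (Stalk (.closed x)) (TorMod (l x)))
    | .generic =>
      { smul := fun _ _ => PUnit.unit
        one_smul := fun _ => rfl
        mul_smul := fun _ _ _ => rfl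
        smul_zero := fun _ => rfl
        zero_smul := fun _ => rfl }
  gen _ _ := PUnit.unit
  gen_zero _ := rfl
  gen_smul _ _ _ := rfl
  gen_generic _ := rfl

theorem torsionData_isGood (l : ClosedPt → ℕ) : (torsionData l).IsGood where
  fg x := by
    classical
    refine ⟨{TorMod.mk (l x) 0}, fun m => ?_⟩
    rcases TorMod.cases m with rfl | ⟨i, _, rfl⟩
    · exact ⟨0, _, Finset.mem_singleton_self _, rfl⟩
    · exact ⟨upow x i, _, Finset.mem_singleton_self _, (TorMod.upow_smul x i 0).symm⟩
  normal x a := by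
    refine ⟨smul_zero a, fun m m' h0 h => ?_⟩
    rcases x with x | _
    · rcases stalk_closed_cases a with rfl | ⟨k, rfl⟩
      · exact absurd rfl h0
      · rcases TorMod.cases m with rfl | ⟨i, hi, rfl⟩
        · exact absurd rfl h0
        · have h0' : TorMod.mk (l x) (k + i) ≠ 0 := by
            rw [← TorMod.upow_smul x]
            exact h0
          have h1 : k + i < l x := by
            by_contra h2
            exact h0' ((TorMod.mk_eq_zero _).2 (by omega))
          have h2 : TorMod.mk (l x) (k + i) = upow x k • m' :=
            (TorMod.upow_smul x k i).symm.trans h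
          rcases TorMod.cases m' with rfl | ⟨j, hj, rfl⟩
          · exact absurd h2 h0'
          · have := TorMod.mk_inj h1 (h2.trans (TorMod.upow_smul x k j))
            rw [show i = j by omega]
    · rfl
  loc_surj x e := ⟨0, 0, rfl⟩
  loc_inj x m m' _ := by
    have key : ∀ m : TorMod (l x), upow x (l x) • m = 0 := by
      intro m
      rcases TorMod.cases m with rfl | ⟨i, _, rfl⟩
      · rfl
      · rw [TorMod.upow_smul, TorMod.mk_eq_zero]
        omega
    exact ⟨l x, (key m).trans (key m').symm⟩

/-- The torsion sheaf `T_{x,n}` supported at the closed point `x`. -/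
def torsionSheaf (x : ClosedPt) (n : ℕ) : CohN P1 :=
  (torsionData (Pi.single x n)).toCohN (torsionData_isGood _)

/-- The `⟨t, t⁻¹⟩`-module `C_n`: its nonzero elements are indexed by `ℤ/nℤ`, and `t ^ k` sends the
element with index `i` to the one with index `i + k`. -/
abbrev CycMod (n : ℕ) : Type := WithZero (Multiplicative (ZMod n))

/-- The map `⟨t, t⁻¹⟩ → C_n` sending `t ^ k` to the element with index `k` (a homomorphism of
monoids with zero for the addition of indices). -/
def cycHom (n : ℕ) : Stalk .generic →*₀ CycMod n :=
  WithZero.map' (AddMonoidHom.toMultiplicative (Int.castAddHom (ZMod n)))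

/-- Gluing data for the cyclic sheaf `C_n`: copies of `C_n` over both charts, glued along the
identity. -/
def cyclicData (n : ℕ) : GluingData where
  M _ := CycMod n
  act x := MulActionWithZero.compHom (CycMod n) ((cycHom n).comp (genO x))
  gen _ m := m
  gen_zero _ := rfl
  gen_smul _ _ _ := rfl
  gen_generic _ := rfl

theorem cyclicData_isGood (n : ℕ+) : (cyclicData n).IsGood where
  fg x := by
    have : Fintype (CycMod n) := inferInstanceAs (Fintype (Option (ZMod n)))
    exact ⟨(Finset.univ : Finset (CycMod n)), fun m =>
      ⟨1, m, Finset.mem_univ (α := CycMod n) m, (one_smul _ _).symm⟩⟩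
  normal x a := by
    refine ⟨smul_zero a, fun (m m' : CycMod n) h0 h => ?_⟩
    have h1 : cycHom n (genO x a) * m = cycHom n (genO x a) * m' := h
    exact mul_left_cancel₀ (M₀ := CycMod n) (fun h2 => h0 (by
      change cycHom n (genO x a) * m = 0
      rw [h2, zero_mul])) h1
  loc_surj x e := by
    refine ⟨0, e, ?_⟩
    rw [upow_zero, map_one]
    exact one_smul _ _
  loc_inj x m m' h := ⟨0, congrArg _ h⟩

/-- The cyclic sheaf `C_n`. -/
def cyclicSheaf (n : ℕ+) : CohN P1 := (cyclicData n).toCohN (cyclicData_isGood n)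

/-- The labels of the indecomposable sheaves `O(k)`, `T_{x,n}` and `C_m`. -/
inductive Block
  | line (k : ℤ)
  | torsion (x : ClosedPt) (n : ℕ+)
  | cyclic (m : ℕ+)

/-- The sheaf with a given label. -/
def Block.sheaf : Block → CohN P1
  | .line k => lineBundle k
  | .torsion x n => torsionSheaf x n
  | .cyclic m => cyclicSheaf m

/-- Rank, degree, and multiplicities of the cyclic sheaves, for the sheaf with a given label. -/
noncomputable def Block.invariants : Block → ℤ × ℤ × (ℕ+ →₀ ℤ)
  | .line k => (1, k, 0)
  | .torsion _ n => (0, (n : ℤ), 0)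
  | .cyclic m => (0, 0, Finsupp.single m 1)

end MonSch

/-! Every point `x` has a smallest open neighbourhood `nbd x`, and every nonempty affine open is one
of these. Hence sections over affine opens are stalks: up to the identifications that matter in the
Grothendieck group, a normal coherent sheaf is a module at `0` and a module at `∞`, both finitely
generated, with a common localization at `η` (`stalks`, `IsGood`), and exactness is tested on the
three stalks. Two homomorphisms, `K0.ofInvariants` and `K0.invariants`, are built and shown to be
inverse to each other.

Generation. Let `g ≠ 0` lie in the stalk at a closed point `x`, with image `e` at `η`. If `e = 0`,
then `g` generates a copy of some `T_{x,n}`. If the powers of `t` move `e` freely, `g` lies in an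
embedded line bundle. If the stabilizer of `e` is `mℤ` with `m ≥ 1`, the orbit of `e` lifts to an
embedded `C_m`. This is `IsGood.exists_block`. The cokernel of such an embedding is again good
(`Hom.coker_isGood`) and needs fewer generators, so by `devissage` the classes of the indecomposable
sheaves generate. The quotient of `O(k + a + b)` by `O(k)` can be any torsion sheaf with lengths `a`
at `0` and `b` at `∞`; so a torsion class depends only on `a + b`, and `[O]`, `[T_{0,1}]` and the
`[C_m]` suffice.

Independence. For every twist `j`, sum over all `z` in the generic module the number of nonzero
elements over `t ^ j z` at `0`, plus the number over `z` at `∞`, minus one if `z ≠ 0`. This is a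
set-theoretic Čech Euler characteristic of the `j`-th twist. It equals `k + 1 + j` for `O(k)`, `n`
for `T_{x,n}` and `m` for `C_m`. It is additive in short exact sequences (`HasEuler.add`). The
delicate point is that a torsion element of the quotient may lift to an element with nonzero image
at `η`, lying in the subsheaf there; such an element is counted at another `z`, but the total stays
the same. The number of generic elements with stabilizer `mℤ` is additive as well, and it is `m`
times the multiplicity of `C_m`. These numbers determine rank, degree and multiplicities
(`HasInvariants.unique`), and devissage shows that they exist for every sheaf. -/

namespace MonSch

open GluingData

/-! ## Gluing data: morphisms, exact sequences, quotients -/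

namespace GluingData

/-- A morphism of gluing data. -/
structure Hom (D E : GluingData) where
  app : ∀ x, D.M x → E.M x
  map_zero : ∀ x, app x 0 = 0
  map_smul : ∀ x (a : Stalk x) (m : D.M x), app x (a • m) = a • app x m
  map_gen : ∀ x (m : D.M x), app .generic (D.gen x m) = E.gen x (app x m)

/-- A short exact sequence of gluing data: at every point, the first map is injective, its image is
the kernel of the second map, and the second map is normal and surjective. -/
structure IsShortExact {D E G : GluingData} (i : Hom D E) (p : Hom E G) : Prop where
  inj : ∀ x, Function.Injective (i.app x)
  exact : ∀ x m, p.app x m = 0 ↔ ∃ n, i.app x n = m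
  normal : ∀ x m m', p.app x m ≠ 0 → p.app x m = p.app x m' → m = m'
  surj : ∀ x, Function.Surjective (p.app x)

theorem IsShortExact.comp_eq_zero {D E G : GluingData} {i : Hom D E} {p : Hom E G}
    (h : IsShortExact i p) (x : Pt) (m : D.M x) : p.app x (i.app x m) = 0 :=
  (h.exact x _).2 ⟨m, rfl⟩

theorem Hom.app_eq_zero {D E : GluingData} {i : Hom D E} {x : Pt}
    (h : Function.Injective (i.app x)) {m : D.M x} : i.app x m = 0 ↔ m = 0 :=
  ⟨fun h0 => h (h0.trans (i.map_zero x).symm), fun h0 => h0 ▸ i.map_zero x⟩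

/-! ### Orbits and stabilizers of the powers of `t`. -/

section tpow

variable {M : Type} [Zero M] [MulActionWithZero (Stalk .generic) M]

theorem tpow_smul_tpow_smul (j k : ℤ) (z : M) : tpow j • tpow k • z = tpow (j + k) • z := by
  rw [tpow_add, mul_smul]

theorem tpow_zero_smul (z : M) : tpow 0 • z = z := one_smul (Stalk .generic) z

theorem tpow_smul_injective (j : ℤ) : Function.Injective (fun z : M => tpow j • z) := by
  intro z z' h
  have h1 := congrArg (tpow (-j) • ·) h
  simpa only [tpow_smul_tpow_smul, neg_add_cancel, tpow_zero_smul] using h1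

theorem tpow_smul_eq_zero {j : ℤ} {z : M} : tpow j • z = 0 ↔ z = 0 :=
  ⟨fun h => tpow_smul_injective j (h.trans (smul_zero (tpow j)).symm), fun h => by rw [h, smul_zero]⟩

/-- The stabilizer is a subgroup of `ℤ`, hence cyclic. The value `a = 0` means a free orbit; the
sign of `a` is not normalized. -/
theorem exists_stabilizer (e : M) : ∃ a : ℤ, ∀ k, tpow k • e = e ↔ a ∣ k := by
  let S : AddSubgroup ℤ :=
    { carrier := {k | tpow k • e = e}
      zero_mem' := tpow_zero_smul e
      add_mem' := fun {a b} (ha : tpow a • e = e) (hb : tpow b • e = e) => by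
        change tpow (a + b) • e = e
        rw [← tpow_smul_tpow_smul, hb, ha]
      neg_mem' := fun {a} (ha : tpow a • e = e) => by
        change tpow (-a) • e = e
        nth_rw 1 [← ha]
        rw [tpow_smul_tpow_smul, neg_add_cancel, tpow_zero_smul] }
  obtain ⟨a, ha⟩ := Int.subgroup_cyclic S
  refine ⟨a, fun k => ?_⟩
  have h1 : tpow k • e = e ↔ k ∈ S := Iff.rfl
  rw [h1, ha, ← AddSubgroup.zmultiples_eq_closure, Int.mem_zmultiples_iff]

end tpow

theorem gen_upow_smul (D : GluingData) (x : ClosedPt) (k : ℕ) (m : D.M (.closed x)) :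
    D.gen _ (upow x k • m) = tpow (sgn x * k) • D.gen _ m := by
  rw [D.gen_smul, genO_upow]

/-- Localization is injective away from the preimage of zero: two elements with the same nonzero
generic image agree after multiplication by some `u ^ k`, the product is nonzero because it is
nonzero at `η`, and normality cancels `u ^ k`. -/
theorem IsGood.gen_inj {D : GluingData} (hD : D.IsGood) :
    ∀ {x : Pt} {m m' : D.M x}, D.gen x m ≠ 0 → D.gen x m = D.gen x m' → m = m'
  | .generic, m, m', _, h => by rwa [D.gen_generic, D.gen_generic] at h
  | .closed x, m, m', h0, h => by
    obtain ⟨k, hk⟩ := hD.loc_inj x m m' h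
    refine (hD.normal _ (upow x k)).2 m m' (fun h1 => h0 ?_) hk
    have h2 := congrArg (D.gen _) h1
    rwa [gen_upow_smul, D.gen_zero, tpow_smul_eq_zero] at h2

theorem Hom.injective_of_gen {D E : GluingData} (i : Hom D E) (x : Pt)
    (hD : Function.Injective (D.gen x)) (hi : Function.Injective (i.app .generic)) :
    Function.Injective (i.app x) := fun m m' h =>
  hD (hi (by rw [i.map_gen, i.map_gen, h]))

/-! ### The cokernel of an injective morphism -/

namespace Hom

variable {B D : GluingData} (i : Hom B D)

/-- Two elements are identified in the cokernel if they are equal or both lie in the image. -/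
def cokerSetoid (x : Pt) : Setoid (D.M x) where
  r m m' := m = m' ∨ (∃ n, i.app x n = m) ∧ ∃ n, i.app x n = m'
  iseqv :=
    { refl := fun _ => Or.inl rfl
      symm := fun h => h.elim (fun h => Or.inl h.symm) fun h => Or.inr h.symm
      trans := by
        rintro a b c (rfl | ⟨h1, h2⟩) (rfl | ⟨h3, h4⟩)
        · exact Or.inl rfl
        · exact Or.inr ⟨h3, h4⟩
        · exact Or.inr ⟨h1, h2⟩
        · exact Or.inr ⟨h1, h4⟩ }

theorem range_smul {x : Pt} (a : Stalk x) {m : D.M x} :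
    (∃ n, i.app x n = m) → ∃ n, i.app x n = a • m := by
  rintro ⟨n, rfl⟩
  exact ⟨a • n, i.map_smul _ _ _⟩

theorem range_gen {x : Pt} {m : D.M x} :
    (∃ n, i.app x n = m) → ∃ n, i.app .generic n = D.gen x m := by
  rintro ⟨n, rfl⟩
  exact ⟨B.gen x n, i.map_gen _ _⟩

instance (x : Pt) : Zero (Quotient (i.cokerSetoid x)) := ⟨Quotient.mk _ 0⟩

instance (x : Pt) : MulActionWithZero (Stalk x) (Quotient (i.cokerSetoid x)) where
  smul a := Quotient.map (a • ·) fun _ _ h => h.elim (fun h => Or.inl (by rw [h]))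
    fun h => Or.inr ⟨i.range_smul a h.1, i.range_smul a h.2⟩
  one_smul := by
    rintro ⟨m⟩
    exact congrArg (Quotient.mk _) (one_smul _ m)
  mul_smul := by
    rintro a b ⟨m⟩
    exact congrArg (Quotient.mk _) (mul_smul a b m)
  smul_zero a := congrArg (Quotient.mk _) (smul_zero a)
  zero_smul := by
    rintro ⟨m⟩
    exact congrArg (Quotient.mk _) (zero_smul _ m)

/-- The cokernel of a morphism of gluing data: the image is collapsed to the base point. -/
def coker : GluingData where
  M x := Quotient (i.cokerSetoid x)
  gen x := Quotient.map (D.gen x) fun _ _ h => h.elim (fun h => Or.inl (by rw [h]))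
    fun h => Or.inr ⟨i.range_gen h.1, i.range_gen h.2⟩
  gen_zero x := congrArg (Quotient.mk _) (D.gen_zero x)
  gen_smul := by
    rintro x a ⟨m⟩
    exact congrArg (Quotient.mk _) (D.gen_smul x a m)
  gen_generic := by
    rintro ⟨m⟩
    exact congrArg (Quotient.mk _) (D.gen_generic m)

/-- The projection to the cokernel. -/
def toCoker : Hom D i.coker where
  app x m := Quotient.mk (i.cokerSetoid x) m
  map_zero _ := rfl
  map_smul _ _ _ := rfl
  map_gen _ _ := rfl

variable {i}

theorem toCoker_eq_zero {x : Pt} {m : D.M x} :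
    i.toCoker.app x m = 0 ↔ ∃ n, i.app x n = m := by
  constructor
  · intro h
    rcases Quotient.exact (s := i.cokerSetoid x) h with h | h
    · exact ⟨0, h ▸ i.map_zero x⟩
    · exact h.1
  · exact fun h => Quotient.sound (s := i.cokerSetoid x) (Or.inr ⟨h, 0, i.map_zero x⟩)

theorem toCoker_normal {x : Pt} {m m' : D.M x} (h0 : i.toCoker.app x m ≠ 0)
    (h : i.toCoker.app x m = i.toCoker.app x m') : m = m' := by
  rcases Quotient.exact (s := i.cokerSetoid x) h with h | h
  · exact h
  · exact absurd (toCoker_eq_zero.2 h.1) h0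

theorem toCoker_surjective (x : Pt) : Function.Surjective (i.toCoker.app x) :=
  Quotient.mk_surjective

theorem isShortExact_coker (hi : ∀ x, Function.Injective (i.app x)) :
    IsShortExact i i.toCoker where
  inj := hi
  exact _ _ := toCoker_eq_zero
  normal _ _ _ := toCoker_normal
  surj := toCoker_surjective

/-- Only the image of `B` is collapsed, so an equality of nonzero classes lifts to an equality in
`D`, and normality is inherited. Localization commutes with the collapse because `B` is itself
localized surjectively. -/
theorem coker_isGood (hB : B.IsGood) (hD : D.IsGood) : i.coker.IsGood where
  fg x := by
    classical
    obtain ⟨S, hS⟩ := hD.fg x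
    refine ⟨S.image (i.toCoker.app _), fun m => ?_⟩
    obtain ⟨m, rfl⟩ := toCoker_surjective _ m
    obtain ⟨a, g, hg, rfl⟩ := hS m
    exact ⟨a, _, Finset.mem_image_of_mem _ hg, i.toCoker.map_smul _ _ _⟩
  normal x a := by
    refine ⟨smul_zero a, fun m m' h0 h => ?_⟩
    obtain ⟨m, rfl⟩ := toCoker_surjective _ m
    obtain ⟨m', rfl⟩ := toCoker_surjective _ m'
    simp only [← i.toCoker.map_smul] at h0 h
    have h1 := toCoker_normal h0 h
    refine congrArg _ ((hD.normal x a).2 m m' (fun h2 => h0 ?_) h1)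
    exact (congrArg _ h2).trans (i.toCoker.map_zero x)
  loc_surj x e := by
    obtain ⟨e, rfl⟩ := toCoker_surjective _ e
    obtain ⟨k, m, h⟩ := hD.loc_surj x e
    exact ⟨k, i.toCoker.app _ m, by rw [← i.toCoker.map_smul, h, i.toCoker.map_gen]⟩
  loc_inj x m m' h := by
    obtain ⟨m, rfl⟩ := toCoker_surjective _ m
    obtain ⟨m', rfl⟩ := toCoker_surjective _ m'
    rw [← i.toCoker.map_gen, ← i.toCoker.map_gen] at h
    simp only [← i.toCoker.map_smul]
    by_cases h0 : i.toCoker.app _ (D.gen _ m) = 0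
    -- If `m` lies generically in `B`, some `u ^ k` makes its generic image come from an element `b`
    -- at `x`, and a further power of `u` makes it equal to the image of a multiple of `b`. The free
    -- exponent `j` allows a common exponent for `m` and `m'`.
    · have key : ∀ m : D.M (.closed x), i.toCoker.app _ (D.gen _ m) = 0 →
          ∃ k, ∀ j, i.toCoker.app _ (upow x (j + k) • m) = 0 := by
        intro m h0
        obtain ⟨n, hn⟩ := toCoker_eq_zero.1 h0
        obtain ⟨k, b, hb⟩ := hB.loc_surj x n
        have h1 : D.gen _ (upow x k • m) = D.gen _ (i.app _ b) := by
          rw [D.gen_smul, ← hn, ← i.map_smul, hb, i.map_gen]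
        obtain ⟨l, hl⟩ := hD.loc_inj x _ _ h1
        refine ⟨l + k, fun j => toCoker_eq_zero.2 ?_⟩
        rw [upow_add, upow_add, mul_smul, mul_smul, hl]
        exact i.range_smul _ (i.range_smul _ ⟨b, rfl⟩)
      obtain ⟨k, hk⟩ := key m h0
      obtain ⟨k', hk'⟩ := key m' (h ▸ h0)
      refine ⟨k' + k, (hk k').trans ?_⟩
      rw [add_comm]
      exact (hk' k).symm
    · obtain ⟨k, hk⟩ := hD.loc_inj x m m' (toCoker_normal h0 h)
      exact ⟨k, congrArg _ hk⟩

end Hom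

end GluingData

/-! ## Devissage -/

/-- Gluing data for the sheaf with a given label. -/
def Block.data : Block → GluingData
  | .line k => lineBundleData k
  | .torsion x n => torsionData (Pi.single x n)
  | .cyclic m => cyclicData m

theorem Block.isGood : ∀ b : Block, b.data.IsGood
  | .line k => lineBundleData_isGood k
  | .torsion _ _ => torsionData_isGood _
  | .cyclic m => cyclicData_isGood m

theorem Block.sheaf_eq (b : Block) : b.sheaf = b.data.toCohN b.isGood := by
  cases b <;> rfl

/-! ### Maps out of torsion modules. -/

namespace TorMod

variable {x : ClosedPt} {M : Type} [Zero M] [MulActionWithZero (Stalk (.closed x)) M] {n : ℕ}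

/-- The map from the cyclic torsion module sending the generator to `g`. -/
def lift (n : ℕ) (g : M) : TorMod n → M
  | none => 0
  | some i => upow x i • g

theorem lift_zero (g : M) : lift (x := x) n g 0 = 0 := rfl

theorem upow_smul_eq_zero_of_le {g : M} {i j : ℕ} (h : upow x i • g = 0) (hij : i ≤ j) :
    upow x j • g = 0 := by
  rw [show j = (j - i) + i by omega, upow_add, mul_smul, h, smul_zero]

theorem lift_mk {g : M} (h : upow x n • g = 0) (i : ℕ) :
    lift (x := x) n g (mk n i) = upow x i • g := by
  by_cases hi : i < n
  · exact congrArg (lift (x := x) n g) (mk_of_lt hi)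
  · rw [mk_of_le (by omega), lift_zero, upow_smul_eq_zero_of_le h (by omega)]

theorem lift_smul {g : M} (h : upow x n • g = 0) (a : Stalk (.closed x)) (m : TorMod n) :
    lift (x := x) n g (a • m) = a • lift (x := x) n g m := by
  rcases stalk_closed_cases a with rfl | ⟨k, rfl⟩
  · rw [zero_smul, zero_smul, lift_zero]
  · rcases TorMod.cases m with rfl | ⟨i, _, rfl⟩
    · rw [smul_zero, lift_zero, smul_zero]
    · rw [upow_smul, lift_mk h, lift_mk h, upow_add, mul_smul]

/-- A coincidence `u ^ i g = u ^ j g ≠ 0` with `i < j` would give, after cancelling `u ^ i` by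
normality, `g = u ^ (j - i) g`. Iterating `n` times gives `g = u ^ (n (j - i)) g = 0`, since `n (j -
i) ≥ n`. -/
theorem lift_injective (hM : IsNormalModule (Stalk (.closed x)) M) {g : M}
    (h : ∀ i, upow x i • g = 0 ↔ n ≤ i) : Function.Injective (lift (x := x) n g) := by
  have h0 : upow x n • g = 0 := (h n).2 le_rfl
  have key : ∀ i j, i ≤ j → i < n → upow x i • g = upow x j • g → i = j := by
    intro i j hij hi he
    by_contra hne
    have hi0 : upow x i • g ≠ 0 := fun h1 => by have := (h i).1 h1; omega
    have h2 : g = upow x (j - i) • g := by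
      refine (hM (upow x i)).2 _ _ hi0 ?_
      change upow x i • g = upow x i • upow x (j - i) • g
      rw [he, ← mul_smul, ← upow_add]
      congr 2
      omega
    have h3 : ∀ k, g = upow x (k * (j - i)) • g := by
      intro k
      induction k with
      | zero => rw [zero_mul, MonSch.upow_zero, one_smul]
      | succ k ih => rw [Nat.succ_mul, upow_add, mul_smul, ← h2, ← ih]
    refine hi0 ?_
    rw [h3 n, upow_smul_eq_zero_of_le h0 (Nat.le_mul_of_pos_right n (by omega)), smul_zero]
  intro m m' he
  rcases TorMod.cases m with rfl | ⟨i, hi, rfl⟩ <;> rcases TorMod.cases m' with rfl | ⟨j, hj, rfl⟩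
  · rfl
  · rw [lift_zero, lift_mk h0] at he
    have := (h j).1 he.symm
    omega
  · rw [lift_zero, lift_mk h0] at he
    have := (h i).1 he
    omega
  · rw [lift_mk h0, lift_mk h0] at he
    rcases le_total i j with hij | hij
    · rw [key i j hij hi he]
    · rw [key j i hij hj he.symm]

end TorMod

/-! ### Embeddings of torsion sheaves and line bundles. -/

namespace GluingData

/-- The morphism from torsion gluing data determined by torsion elements. -/
def torsionHom {D : GluingData} {l : ClosedPt → ℕ} (g : ∀ y, D.M (.closed y))
    (h : ∀ y, upow y (l y) • g y = 0) : Hom (torsionData l) D where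
  app x := match x with
    | .closed y => TorMod.lift (x := y) (l y) (g y)
    | .generic => fun _ => 0
  map_zero x := by cases x <;> rfl
  map_smul x a m := by
    cases x with
    | closed y => exact TorMod.lift_smul (h y) a m
    | generic => exact (smul_zero a).symm
  map_gen x m := by
    cases x with
    | closed y =>
      rcases TorMod.cases m with rfl | ⟨i, _, rfl⟩
      · exact (D.gen_zero _).symm
      -- A torsion element vanishes at the generic point, where `u` acts bijectively.
      · have h1 : D.gen _ (g y) = 0 := by
          have h2 := congrArg (D.gen _) (h y)
          rwa [gen_upow_smul, D.gen_zero, tpow_smul_eq_zero] at h2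
        change 0 = D.gen _ (TorMod.lift (x := y) (l y) (g y) _)
        rw [TorMod.lift_mk (h y), gen_upow_smul, h1, smul_zero]
    | generic => exact (D.gen_zero _).symm

theorem torsionHom_injective {D : GluingData} (hD : D.IsGood) {l : ClosedPt → ℕ}
    (g : ∀ y, D.M (.closed y)) (h : ∀ y i, upow y i • g y = 0 ↔ l y ≤ i) :
    ∀ x, Function.Injective ((torsionHom g fun y => (h y (l y)).2 le_rfl).app x)
  | .closed y => TorMod.lift_injective (hD.normal _) (h y)
  | .generic => fun _ _ _ => rfl

theorem smul_injective_of_free {M : Type} [Zero M] [MulActionWithZero (Stalk .generic) M] {e : M}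
    (h0 : e ≠ 0) (h : ∀ k, tpow k • e = e → k = 0) :
    Function.Injective (fun a : Stalk .generic => a • e) := by
  intro a b (hab : a • e = b • e)
  rcases stalk_generic_cases a with rfl | ⟨j, rfl⟩ <;>
    rcases stalk_generic_cases b with rfl | ⟨k, rfl⟩
  · rfl
  · rw [zero_smul] at hab
    exact absurd (tpow_smul_eq_zero.1 hab.symm) h0
  · rw [zero_smul] at hab
    exact absurd (tpow_smul_eq_zero.1 hab) h0
  · have h1 := congrArg (tpow (-k) • ·) hab
    simp only [tpow_smul_tpow_smul, neg_add_cancel, tpow_zero_smul] at h1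
    have := h _ h1
    rw [show j = k by omega]

/-- The morphism from the gluing data of a line bundle determined by compatible elements. -/
def lineHom {D : GluingData} {k : ℤ} (g : ∀ y, D.M (.closed y))
    (h : D.gen _ (g .zero) = tpow (-k) • D.gen _ (g .infty)) : Hom (lineBundleData k) D where
  app x := match x with
    | .closed y => fun a : Stalk (.closed y) => a • g y
    | .generic => fun a : Stalk .generic => a • D.gen _ (g .infty)
  map_zero x := by cases x <;> exact zero_smul _ _
  map_smul x a m := by cases x <;> exact mul_smul a m _
  map_gen x m := by
    rcases x with (_ | _) | _
    · change (tpow (-k) * genO (.closed .zero) m) • D.gen _ (g .infty) = D.gen _ (m • g .zero)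
      rw [D.gen_smul, h, mul_comm, mul_smul]
    · exact (D.gen_smul _ _ _).symm
    · exact (D.gen_generic _).symm

theorem lineBundleData_gen_injective (k : ℤ) (x : Pt) :
    Function.Injective ((lineBundleData k).gen x) := by
  cases x with
  | closed x =>
    obtain ⟨j, hj⟩ := lineBundleData_gen k x
    intro m m' h
    rw [hj, hj] at h
    exact genO_injective _ ((isUnit_tpow j).mul_left_cancel h)
  | generic => exact fun _ _ h => h

theorem lineHom_injective {D : GluingData} {k : ℤ} (g : ∀ y, D.M (.closed y))
    (h : D.gen _ (g .zero) = tpow (-k) • D.gen _ (g .infty)) (h0 : D.gen _ (g .infty) ≠ 0)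
    (hf : ∀ j, tpow j • D.gen _ (g .infty) = D.gen _ (g .infty) → j = 0) (x : Pt) :
    Function.Injective ((lineHom g h).app x) :=
  (lineHom g h).injective_of_gen x (lineBundleData_gen_injective k x)
    (smul_injective_of_free h0 hf)

end GluingData

/-! ### Cyclic modules as finite orbits, and the devissage. -/

theorem cycHom_surjective (m : ℕ) : Function.Surjective (cycHom m) := by
  intro z
  induction z using WithZero.recZeroCoe with
  | zero => exact ⟨0, map_zero _⟩
  | coe z =>
    obtain ⟨k, hk⟩ := ZMod.intCast_surjective (Multiplicative.toAdd z)
    exact ⟨tpow k, congrArg (fun w : ZMod m => ((Multiplicative.ofAdd w : Multiplicative (ZMod m)) :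
      CycMod m)) hk⟩

theorem cycHom_tpow_ne_zero (m : ℕ) (k : ℤ) : cycHom m (tpow k) ≠ 0 := WithZero.coe_ne_zero

theorem cycHom_eq_zero {m : ℕ} {a : Stalk .generic} : cycHom m a = 0 ↔ a = 0 := by
  refine ⟨fun h => ?_, fun h => h ▸ map_zero _⟩
  rcases stalk_generic_cases a with rfl | ⟨j, rfl⟩
  · rfl
  · exact absurd h (cycHom_tpow_ne_zero m j)

theorem cycHom_tpow_eq_iff {m : ℕ} {j k : ℤ} :
    cycHom m (tpow j) = cycHom m (tpow k) ↔ (m : ℤ) ∣ k - j := by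
  rw [← ZMod.intCast_eq_intCast_iff_dvd_sub]
  exact ⟨fun h => Multiplicative.ofAdd.injective (WithZero.coe_injective h),
    fun h => congrArg (fun w : ZMod m => ((Multiplicative.ofAdd w : Multiplicative (ZMod m)) :
      CycMod m)) h⟩

/-- The reduction of exponents modulo `m` and the orbit map `a ↦ a • e` have the same fibres. One
direction makes the map from `C_m` onto the orbit of `e` (and zero) well defined, the other makes it
injective. -/
theorem cycHom_eq_iff {m : ℕ} {M : Type} [Zero M] [MulActionWithZero (Stalk .generic) M] {e : M}
    (h0 : e ≠ 0) (h : ∀ k, tpow k • e = e ↔ (m : ℤ) ∣ k) (a b : Stalk .generic) :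
    cycHom m a = cycHom m b ↔ a • e = b • e := by
  rcases stalk_generic_cases a with rfl | ⟨j, rfl⟩ <;>
    rcases stalk_generic_cases b with rfl | ⟨k, rfl⟩
  · simp
  · rw [map_zero, zero_smul]
    exact iff_of_false (cycHom_tpow_ne_zero m k).symm fun h1 => h0 (tpow_smul_eq_zero.1 h1.symm)
  · rw [map_zero, zero_smul]
    exact iff_of_false (cycHom_tpow_ne_zero m j) fun h1 => h0 (tpow_smul_eq_zero.1 h1)
  · rw [cycHom_tpow_eq_iff, ← h, ← (tpow_smul_injective j).eq_iff]
    rw [tpow_smul_tpow_smul, add_sub_cancel, eq_comm]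

namespace GluingData

/-- A finite orbit at `η` extends over both closed points: since `t ^ (m N)` fixes it, clearing
denominators and then continuing around the cycle returns to the starting element. The lifts are
unique by `IsGood.gen_inj`, and therefore equivariant; every element over `e` is the chosen lift. -/
theorem exists_cyclicHom {D : GluingData} (hD : D.IsGood) (m : ℕ+) {e : D.M .generic} (h0 : e ≠ 0)
    (h : ∀ k, tpow k • e = e ↔ ((m : ℕ) : ℤ) ∣ k) :
    ∃ i : Hom (cyclicData m) D, (∀ x, Function.Injective (i.app x)) ∧
      ∀ x (g : D.M x), D.gen x g = e → ∃ n, i.app x n = g := by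
  let f : CycMod m → D.M .generic := fun z => Function.surjInv (cycHom_surjective m) z • e
  have hf : ∀ a, f (cycHom m a) = a • e := fun a =>
    (cycHom_eq_iff h0 h _ _).1 (Function.surjInv_eq (cycHom_surjective m) _)
  have hf0 : f 0 = 0 := by rw [← map_zero (cycHom m), hf, zero_smul]
  have hinj : Function.Injective f := by
    intro z z' hz
    obtain ⟨a, rfl⟩ := cycHom_surjective m z
    obtain ⟨b, rfl⟩ := cycHom_surjective m z'
    rw [hf, hf] at hz
    exact (cycHom_eq_iff h0 h a b).2 hz
  -- Torsion elements also lie over `0`, so the lift of `0` has to be prescribed.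
  have hsurj : ∀ x z, ∃ g : D.M x, D.gen x g = f z ∧ (z = 0 → g = 0) := by
    intro x z
    by_cases hz : z = 0
    · exact ⟨0, by rw [hz, D.gen_zero, hf0], fun _ => rfl⟩
    · suffices ∃ g : D.M x, D.gen x g = f z from this.imp fun g hg => ⟨hg, fun h => absurd h hz⟩
      cases x with
      | generic => exact ⟨f z, D.gen_generic _⟩
      | closed x =>
        obtain ⟨a, rfl⟩ := cycHom_surjective m z
        rw [hf]
        rcases stalk_generic_cases a with rfl | ⟨j, rfl⟩
        · exact absurd (map_zero _) hz
        · obtain ⟨N, g, hg⟩ := hD.loc_surj x (tpow j • e)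
          -- `g` lies over `u ^ N • (tpow j • e)`; multiplying by `u ^ ((m - 1) N)` completes the
          -- exponent to `m N`, which acts trivially on the orbit.
          refine ⟨upow x ((m - 1) * N) • g, ?_⟩
          rw [gen_upow_smul, ← hg, genO_upow, tpow_smul_tpow_smul, tpow_smul_tpow_smul,
            ← (tpow_smul_injective (-j)).eq_iff]
          simp only [tpow_smul_tpow_smul, neg_add_cancel, tpow_zero_smul]
          rw [h]
          refine ⟨sgn x * N, ?_⟩
          push_cast [Nat.cast_sub (show 1 ≤ (m : ℕ) from m.pos)]
          ring
  choose F hF hF0 using hsurj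
  let i : Hom (cyclicData m) D :=
    { app := F
      map_zero := fun x => hF0 x _ rfl
      map_smul := fun x a (z : CycMod m) => by
        change F x (cycHom m (genO x a) * z : CycMod m) = a • F x z
        by_cases hz : (cycHom m (genO x a) * z : CycMod m) = 0
        · rw [hF0 x _ hz]
          rcases mul_eq_zero.1 hz with h1 | h1
          · rw [genO_injective x ((cycHom_eq_zero.1 h1).trans (map_zero _).symm), zero_smul]
          · rw [hF0 x _ h1, smul_zero]
        · refine hD.gen_inj ?_ ?_
          · rw [hF, ← hf0]
            exact fun h1 => hz (hinj h1)
          · rw [hF, D.gen_smul, hF]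
            obtain ⟨b, hb⟩ := cycHom_surjective m z
            rw [← hb, ← map_mul, hf, hf, mul_smul]
      map_gen := fun x (z : CycMod m) => by
        have h1 := hF .generic z
        rw [D.gen_generic] at h1
        exact h1.trans (hF x z).symm }
  refine ⟨i, fun x z z' hz => hinj ?_, fun x g hg => ⟨cycHom m 1, ?_⟩⟩
  · rw [← hF x z, ← hF x z']
    exact congrArg _ hz
  · have h1 : D.gen x (F x (cycHom m 1)) = e := by rw [hF, hf, one_smul]
    exact hD.gen_inj (h1 ▸ h0) (h1.trans hg.symm)

/-- Every nonzero element of the module at a closed point lies in the image of an injective morphism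
from the gluing data of an indecomposable sheaf. -/
theorem IsGood.exists_block {D : GluingData} (hD : D.IsGood) (x : ClosedPt) {g : D.M (.closed x)}
    (hg : g ≠ 0) : ∃ (b : Block) (i : Hom b.data D), (∀ y, Function.Injective (i.app y)) ∧
      ∃ n, i.app _ n = g := by
  classical
  by_cases h0 : D.gen _ g = 0
  · have hex : ∃ k, upow x k • g = 0 := by
      obtain ⟨k, hk⟩ := hD.loc_inj x g 0 (h0.trans (D.gen_zero _).symm)
      exact ⟨k, hk.trans (smul_zero _)⟩
    -- The length of the torsion sheaf is the least exponent that kills `g`.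
    have hn : ∀ i, upow x i • g = 0 ↔ Nat.find hex ≤ i := fun i =>
      ⟨fun h => Nat.find_le h, TorMod.upow_smul_eq_zero_of_le (Nat.find_spec hex)⟩
    have hpos : 0 < Nat.find hex := by
      rw [Nat.pos_iff_ne_zero]
      intro h1
      exact hg ((one_smul (Stalk (.closed x)) g).symm.trans ((hn 0).2 h1.le))
    let G : ∀ y, D.M (.closed y) := Function.update (fun _ => 0) x g
    have hG : ∀ y i, upow y i • G y = 0 ↔ (Pi.single x (Nat.find hex) : ClosedPt → ℕ) y ≤ i := by
      intro y i
      by_cases hy : y = x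
      · subst hy
        rw [Pi.single_eq_same, ← hn, show G y = g from Function.update_self _ _ _]
      · simp only [G, Function.update_of_ne hy, Pi.single_eq_of_ne hy, smul_zero, zero_le]
    refine ⟨.torsion x ⟨Nat.find hex, hpos⟩, torsionHom G fun y => (hG y _).2 le_rfl,
      torsionHom_injective hD G hG, TorMod.mk _ 0, ?_⟩
    refine (TorMod.lift_mk ((hG x _).2 le_rfl) 0).trans ?_
    rw [MonSch.upow_zero, one_smul]
    exact Function.update_self _ _ _
  · obtain ⟨a, ha⟩ := exists_stabilizer (D.gen _ g)
    by_cases ha0 : a = 0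
    · have hex : ∀ y : ClosedPt, ∃ (h : D.M (.closed y)) (k : ℤ),
          D.gen _ h = tpow k • D.gen _ g := fun y => by
        obtain ⟨k, h, hk⟩ := hD.loc_surj y (D.gen _ g)
        exact ⟨h, _, hk.symm⟩
      choose H K hK using hex
      -- The local generators are `g` itself at `x`, and at the other closed point any element over
      -- a translate `t ^ K` of the generic image of `g`. The difference of the two shifts, `∞`
      -- minus `0`, is the degree of the line bundle.
      let G : ∀ y, D.M (.closed y) := Function.update H x g
      have hGK : ∀ y, D.gen _ (G y) = tpow (Function.update K x 0 y) • D.gen _ g := by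
        intro y
        by_cases hy : y = x
        · subst hy
          simp only [G, Function.update_self, tpow_zero_smul]
        · simp only [G, Function.update_of_ne hy, hK]
      have hfree : ∀ j l, tpow j • tpow l • D.gen _ g = tpow l • D.gen _ g → j = 0 := by
        intro j l h
        rw [tpow_smul_tpow_smul, add_comm, ← tpow_smul_tpow_smul] at h
        have := (ha j).1 (tpow_smul_injective l h)
        rwa [ha0, zero_dvd_iff] at this
      have h1 : D.gen _ (G .zero) = tpow (-(Function.update K x 0 .infty -
          Function.update K x 0 .zero)) • D.gen _ (G .infty) := by
        rw [hGK, hGK, tpow_smul_tpow_smul]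
        congr 2
        ring
      refine ⟨.line _, lineHom G h1, lineHom_injective G h1 ?_ ?_, (1 : Stalk (.closed x)), ?_⟩
      · rw [hGK, Ne, tpow_smul_eq_zero]
        exact h0
      · rw [hGK]
        exact fun j => hfree j _
      · exact (one_smul _ _).trans (Function.update_self _ _ _)
    · obtain ⟨i, hi, hi'⟩ := exists_cyclicHom hD ⟨a.natAbs, Int.natAbs_pos.2 ha0⟩ h0
        fun k => (ha k).trans Int.natAbs_dvd.symm
      exact ⟨.cyclic _, i, hi, hi' _ g rfl⟩

/-- A property of gluing data which holds for zero data and the data of the indecomposable sheaves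
and is closed under extensions holds for all good gluing data. -/
theorem devissage {P : ∀ D : GluingData, D.IsGood → Prop}
    (zero : ∀ D hD, (∀ x (m : D.M x), m = 0) → P D hD) (block : ∀ b : Block, P b.data b.isGood)
    (ext : ∀ {D E G} (hD hE hG) (i : Hom D E) (p : Hom E G), IsShortExact i p → P D hD → P G hG →
      P E hE) (D : GluingData) (hD : D.IsGood) : P D hD := by
  classical
  -- Induction on the total number of generators at the two closed points. Only nonzero elements
  -- need to be generated, so `0` may be discarded from a generating set.
  suffices ∀ (n : ℕ) (D : GluingData) (hD : D.IsGood) (S : ∀ x, Finset (D.M (.closed x))),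
      (∀ x (m : D.M (.closed x)), m ≠ 0 → ∃ a : Stalk (.closed x), ∃ g ∈ S x, m = a • g) →
      (S .zero).card + (S .infty).card ≤ n → P D hD by
    choose S hS using hD.fg
    exact this _ D hD S (fun x m _ => hS x m) le_rfl
  intro n
  induction n with
  | zero =>
    intro D hD S hS hn
    have h0 : ∀ x (m : D.M (.closed x)), m = 0 := by
      intro x m
      by_contra hm
      obtain ⟨a, g, hg, -⟩ := hS x m hm
      have := Finset.card_pos.2 ⟨g, hg⟩
      cases x <;> omega
    refine zero D hD ?_
    rintro (x | _) e
    · exact h0 x e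
    · obtain ⟨k, m, hm⟩ := hD.loc_surj .zero e
      rw [h0 _ m, D.gen_zero, genO_upow, tpow_smul_eq_zero] at hm
      exact hm
  | succ n ih =>
    intro D hD S hS hn
    by_cases h0 : ∃ x, ∃ g ∈ S x, g ≠ 0
    · obtain ⟨x, g, hgS, hg⟩ := h0
      obtain ⟨b, i, hi, r, hr⟩ := hD.exists_block x hg
      refine ext b.isGood hD (Hom.coker_isGood b.isGood hD) i i.toCoker
        (Hom.isShortExact_coker hi) (block b) ?_
      have hle : ∀ y, (((S y).image (i.toCoker.app _)).erase 0).card ≤ (S y).card := fun y =>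
        (Finset.card_erase_le).trans Finset.card_image_le
      -- The generator `g` lies in the image of the embedded block, so its class is `0` and is
      -- erased.
      have hlt : (((S x).image (i.toCoker.app _)).erase 0).card < (S x).card := by
        refine (Finset.card_erase_lt_of_mem ?_).trans_le Finset.card_image_le
        exact Finset.mem_image.2 ⟨g, hgS, Hom.toCoker_eq_zero.2 ⟨r, hr⟩⟩
      refine ih _ _ (fun y => ((S y).image (i.toCoker.app _)).erase 0) ?_ ?_
      · intro y m hm
        obtain ⟨m, rfl⟩ := Hom.toCoker_surjective _ m
        obtain ⟨a, h, hh, rfl⟩ := hS y m fun h1 => hm (h1 ▸ i.toCoker.map_zero _)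
        refine ⟨a, _, Finset.mem_erase.2 ⟨fun h1 => hm ?_, Finset.mem_image_of_mem _ hh⟩,
          i.toCoker.map_smul _ _ _⟩
        rw [i.toCoker.map_smul, h1, smul_zero]
      · have h1 := hle .zero
        have h2 := hle .infty
        cases x <;> omega
    -- All generators are zero, so there is no nonzero element to generate and the empty set will
    -- do.
    · refine ih D hD (fun _ => ∅) (fun x m hm => ?_) (by simp)
      obtain ⟨a, g, hg, rfl⟩ := hS x m hm
      by_contra
      refine h0 ⟨x, g, hg, fun h1 => hm ?_⟩
      rw [h1, smul_zero]

end GluingData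

/-! ## Rank, degree and cyclic multiplicities of gluing data -/

/-- Counting a finite set by the values of `φ`. It is phrased with `HasSum` because the values will
lie in a possibly infinite generic module. -/
theorem hasSum_ncard_fiber {α β : Type} {K : Set α} (hK : K.Finite) (φ : α → β) :
    HasSum (fun z => ({k ∈ K | φ k = z}.ncard : ℤ)) K.ncard := by
  classical
  have h1 : HasSum (fun z => ∑ k ∈ hK.toFinset, if z = φ k then (1 : ℤ) else 0)
      (∑ k ∈ hK.toFinset, 1) := hasSum_sum fun k _ => hasSum_ite_eq (φ k) 1
  rw [Finset.sum_const, nsmul_one, ← Set.ncard_eq_toFinset_card K hK] at h1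
  convert h1 using 2 with z
  rw [Finset.sum_boole, Set.ncard_eq_toFinset_card _ (hK.subset (Set.sep_subset _ _))]
  congr 2
  ext k
  simp [eq_comm]

namespace GluingData

/-- The action of a power of `t` on a module over `⟨t, t⁻¹⟩`. -/
def tpowEquiv {M : Type} [Zero M] [MulActionWithZero (Stalk .generic) M] (j : ℤ) : M ≃ M where
  toFun z := tpow j • z
  invFun z := tpow (-j) • z
  left_inv z := by
    change tpow (-j) • tpow j • z = z
    rw [tpow_smul_tpow_smul, neg_add_cancel, tpow_zero_smul]
  right_inv z := by
    change tpow j • tpow (-j) • z = z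
    rw [tpow_smul_tpow_smul, add_neg_cancel, tpow_zero_smul]

/-- The set of nonzero elements of the module at `x` over an element of the generic module. -/
def fiber (D : GluingData) (x : ClosedPt) (z : D.M .generic) : Set (D.M (.closed x)) :=
  {m | m ≠ 0 ∧ D.gen _ m = z}

open Classical in
/-- The contribution of an element of the generic module to the Euler characteristic of the `j`-th
twist. -/
noncomputable def eulerWeight (D : GluingData) (j : ℤ) (z : D.M .generic) : ℤ :=
  (D.fiber .zero (tpow j • z)).ncard + (D.fiber .infty z).ncard - if z = 0 then 0 else 1

theorem eulerWeight_zero (D : GluingData) (j : ℤ) :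
    D.eulerWeight j 0 = (D.fiber .zero 0).ncard + (D.fiber .infty 0).ncard := by
  rw [eulerWeight, if_pos rfl, smul_zero, sub_zero]

theorem eulerWeight_of_ne_zero {D : GluingData} (j : ℤ) {z : D.M .generic} (hz : z ≠ 0) :
    D.eulerWeight j z = (D.fiber .zero (tpow j • z)).ncard + (D.fiber .infty z).ncard - 1 := by
  rw [eulerWeight, if_neg hz]

/-- The Euler characteristic of the `j`-th twist is defined and equal to `n`. -/
structure HasEuler (D : GluingData) (j n : ℤ) : Prop where
  finite : ∀ x z, (D.fiber x z).Finite
  hasSum : HasSum (D.eulerWeight j) n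

/-- The set of nonzero elements of the generic module which lie on cycles of length `m`. -/
def cycles (D : GluingData) (m : ℕ+) : Set (D.M .generic) :=
  {z | z ≠ 0 ∧ ∀ k, tpow k • z = z ↔ ((m : ℕ) : ℤ) ∣ k}

/-- For all `m`, there are `c m` cycles of length `m` in the generic module. -/
def HasCycles (D : GluingData) (c : ℕ+ →₀ ℤ) : Prop :=
  ∀ m, (D.cycles m).Finite ∧ ((D.cycles m).ncard : ℤ) = m * c m

/-- The number of elements on cycles if there are `c m` cycles of length `m`. -/
noncomputable def cyclesSize : (ℕ+ →₀ ℤ) →+ ℤ :=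
  Finsupp.liftAddHom fun m => AddMonoidHom.mulLeft ((m : ℕ) : ℤ)

/-- The gluing data has rank `a.1`, degree `a.2.1`, and cyclic multiplicities `a.2.2`. -/
structure HasInvariants (D : GluingData) (a : ℤ × ℤ × (ℕ+ →₀ ℤ)) : Prop where
  euler : ∀ j, D.HasEuler j (a.2.1 + (1 + j) * a.1 + cyclesSize a.2.2)
  cycles : D.HasCycles a.2.2

/-- Cycle counts determine the multiplicities, as `m ≠ 0`. The Euler characteristic is then an
affine function of the twist, with slope the rank, so its values at `0` and `1` give rank and
degree. -/
theorem HasInvariants.unique {D : GluingData} {a b : ℤ × ℤ × (ℕ+ →₀ ℤ)} (ha : D.HasInvariants a)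
    (hb : D.HasInvariants b) : a = b := by
  have h2 : a.2.2 = b.2.2 := by
    ext m
    have := (ha.cycles m).2.symm.trans (hb.cycles m).2
    exact mul_left_cancel₀ (by exact_mod_cast m.ne_zero) this
  have h0 := (ha.euler 0).hasSum.unique (hb.euler 0).hasSum
  have h1 := (ha.euler 1).hasSum.unique (hb.euler 1).hasSum
  rw [h2] at h0 h1
  refine Prod.ext ?_ (Prod.ext ?_ h2) <;> linarith

/-! ### Additivity of the invariants in short exact sequences. -/

section Additivity

variable {D E G : GluingData} {i : Hom D E} {p : Hom E G}

/-- The elements of the fibre over `i z` which do not come from `D`. -/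
def extraFiber (i : Hom D E) (p : Hom E G) (x : ClosedPt) (z : D.M .generic) :
    Set (E.M (.closed x)) := {m | p.app _ m ≠ 0 ∧ E.gen _ m = i.app _ z}

/-- An element over `i z` either is killed by `p`, and then comes from `D`, or survives as a torsion
element of `G`. The second kind is what makes additivity nontrivial. -/
theorem IsShortExact.fiber_app (h : IsShortExact i p) (x : ClosedPt) (z : D.M .generic) :
    E.fiber x (i.app _ z) = i.app _ '' D.fiber x z ∪ extraFiber i p x z := by
  ext m
  constructor
  · rintro ⟨h0, h1⟩
    by_cases hp : p.app _ m = 0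
    · obtain ⟨n, rfl⟩ := (h.exact _ m).1 hp
      refine Or.inl ⟨n, ⟨fun hn => h0 (hn ▸ i.map_zero _), h.inj _ ?_⟩, rfl⟩
      rw [i.map_gen, h1]
    · exact Or.inr ⟨hp, h1⟩
  · rintro (⟨n, ⟨h0, rfl⟩, rfl⟩ | ⟨h0, h1⟩)
    · exact ⟨fun h1 => h0 ((Hom.app_eq_zero (h.inj _)).1 h1), (i.map_gen _ _).symm⟩
    · exact ⟨fun h2 => h0 (h2 ▸ p.map_zero _), h1⟩

theorem IsShortExact.injOn (h : IsShortExact i p) (x : Pt) {s : Set (E.M x)}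
    (hs : ∀ m ∈ s, p.app _ m ≠ 0) : Set.InjOn (p.app x) s :=
  fun m hm m' _ h1 => h.normal x m m' (hs m hm) h1

theorem IsShortExact.image_torsion (h : IsShortExact i p) (x : ClosedPt) :
    p.app _ '' {m | p.app _ m ≠ 0 ∧ p.app _ (E.gen (.closed x) m) = 0} = G.fiber x 0 := by
  ext m
  constructor
  · rintro ⟨m, ⟨h0, h1⟩, rfl⟩
    exact ⟨h0, by rw [← p.map_gen, h1]⟩
  · rintro ⟨h0, h1⟩
    obtain ⟨m, rfl⟩ := h.surj _ m
    exact ⟨m, ⟨h0, by rw [p.map_gen, h1]⟩, rfl⟩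

/-- Away from the subobject, `E` and `G` agree both at `x` and at `η` because `p` is normal and
surjective; hence the fibres correspond. -/
theorem IsShortExact.image_fiber (h : IsShortExact i p) (x : ClosedPt) {z : E.M .generic}
    (hz : p.app _ z ≠ 0) : p.app _ '' E.fiber x z = G.fiber x (p.app _ z) := by
  ext m
  constructor
  · rintro ⟨m, ⟨h0, rfl⟩, rfl⟩
    refine ⟨fun h1 => hz ?_, (p.map_gen _ _).symm⟩
    rw [p.map_gen, h1, G.gen_zero]
  · rintro ⟨h0, h1⟩
    obtain ⟨m, rfl⟩ := h.surj _ m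
    refine ⟨m, ⟨fun h2 => h0 (h2 ▸ p.map_zero _), ?_⟩, rfl⟩
    rw [← p.map_gen] at h1
    exact h.normal _ _ _ (h1 ▸ hz) h1

theorem IsShortExact.fiber_ne_zero (x : ClosedPt) {z : E.M .generic}
    (hz : p.app _ z ≠ 0) : ∀ m ∈ E.fiber x z, p.app _ m ≠ 0 := by
  rintro m ⟨-, rfl⟩ h1
  exact hz (by rw [p.map_gen, h1, G.gen_zero])

/-- The elements of `E` outside `D` that lie generically in `D` correspond under `p` to the nonzero
torsion of `G` at `x`. Sorting them by their generic image in `D` gives the sum. -/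
theorem IsShortExact.hasSum_extraFiber (h : IsShortExact i p) (x : ClosedPt)
    (hG : (G.fiber x 0).Finite) :
    (∀ z, (extraFiber i p x z).Finite) ∧
      HasSum (fun z => ((extraFiber i p x z).ncard : ℤ)) (G.fiber x 0).ncard := by
  set K : Set (E.M (.closed x)) := {m | p.app _ m ≠ 0 ∧ p.app _ (E.gen (.closed x) m) = 0}
  have hinj : Set.InjOn (p.app _) K := h.injOn _ fun m hm => hm.1
  have him : p.app _ '' K = G.fiber x 0 := h.image_torsion x
  have hK : K.Finite := (him ▸ hG).of_finite_image hinj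
  have hsub : ∀ z, extraFiber i p x z ⊆ K := fun z m hm =>
    ⟨hm.1, (h.exact _ _).2 ⟨z, hm.2.symm⟩⟩
  refine ⟨fun z => hK.subset (hsub z), ?_⟩
  have hφ : ∀ m : E.M (.closed x), ∃ z, m ∈ K → i.app _ z = E.gen _ m := by
    intro m
    by_cases hm : m ∈ K
    · exact ((h.exact _ _).1 hm.2).imp fun z hz _ => hz
    · exact ⟨0, fun h => absurd h hm⟩
  choose φ hφ using hφ
  have h1 := hasSum_ncard_fiber hK φ
  rw [← him, hinj.ncard_image]
  convert h1 using 4 with z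
  ext m
  constructor
  · exact fun hm => ⟨hsub z hm, h.inj _ ((hφ m (hsub z hm)).trans hm.2)⟩
  · rintro ⟨hm, rfl⟩
    exact ⟨hm.1, (hφ m hm).symm⟩

/-- Generic elements from `D` contribute the sum for `D` plus the torsion of `G` at both points; the
remaining ones contribute the sum for `G` without its term at `0`. That term is exactly the torsion
of `G`, so the corrections cancel. -/
theorem HasEuler.add (h : IsShortExact i p) {j a b : ℤ} (hD : D.HasEuler j a)
    (hG : G.HasEuler j b) : E.HasEuler j (a + b) := by
  classical
  have hex := fun x => h.hasSum_extraFiber x (hG.finite x 0)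
  have hfin : ∀ x z, (E.fiber x z).Finite := by
    intro x z
    by_cases hz : p.app _ z = 0
    · obtain ⟨z, rfl⟩ := (h.exact _ z).1 hz
      rw [h.fiber_app]
      exact ((hD.finite x z).image _).union ((hex x).1 z)
    · have h1 := h.image_fiber x hz
      exact Set.Finite.of_finite_image (h1 ▸ hG.finite x _)
        (h.injOn _ (IsShortExact.fiber_ne_zero x hz))
  refine ⟨hfin, ?_⟩
  have hcard1 : ∀ x z, (E.fiber x (i.app _ z)).ncard =
      (D.fiber x z).ncard + (extraFiber i p x z).ncard := by
    intro x z
    rw [h.fiber_app, Set.ncard_union_eq _ ((hD.finite x z).image _) ((hex x).1 z),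
      Set.ncard_image_of_injective _ (h.inj _)]
    rw [Set.disjoint_left]
    rintro _ ⟨n, -, rfl⟩ hn
    exact hn.1 (h.comp_eq_zero _ _)
  have hcard2 : ∀ x z, p.app _ z ≠ 0 → (E.fiber x z).ncard = (G.fiber x (p.app _ z)).ncard := by
    intro x z hz
    rw [← h.image_fiber x hz, (h.injOn _ (IsShortExact.fiber_ne_zero x hz)).ncard_image]
  -- `A` is the part over the image of `D`, `B` the part over its complement.
  let A : E.M .generic → ℤ := fun z => if p.app _ z = 0 then E.eulerWeight j z else 0
  let B : E.M .generic → ℤ := fun z => if p.app _ z = 0 then 0 else E.eulerWeight j z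
  have hAB : E.eulerWeight j = fun z => A z + B z := by
    ext z
    by_cases hz : p.app _ z = 0 <;> simp [A, B, hz]
  have hA : HasSum A (a + ((G.fiber .zero 0).ncard + (G.fiber .infty 0).ncard)) := by
    rw [← (h.inj .generic).hasSum_iff]
    -- At the point `0` the weight of `z` looks at the fibre over `t ^ j z`; since `t ^ j` permutes
    -- the generic module, this does not change the total.
    · have h1 : HasSum (fun z : D.M .generic =>
          ((extraFiber i p .zero (tpow j • z)).ncard : ℤ)) (G.fiber .zero 0).ncard := by
        have h2 := (hex .zero).2
        rw [← (tpowEquiv (M := D.M .generic) j).hasSum_iff] at h2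
        exact h2
      convert hD.hasSum.add (h1.add (hex .infty).2) using 1
      ext z
      simp only [A, Function.comp_apply, h.comp_eq_zero, if_true, eulerWeight, ← i.map_smul,
        hcard1, Hom.app_eq_zero (h.inj _)]
      push_cast
      ring
    · intro z hz
      exact if_neg fun h1 => hz ((h.exact _ z).1 h1)
  have hB : HasSum B (b - ((G.fiber .zero 0).ncard + (G.fiber .infty 0).ncard)) := by
    -- With its weight at `0` removed, the sum for `G` runs over nonzero generic elements, which `p`
    -- matches with the set `V`.
    have h1 : HasSum (fun z => G.eulerWeight j z - if z = 0 then
        ((G.fiber .zero 0).ncard + (G.fiber .infty 0).ncard : ℤ) else 0) _ :=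
      hG.hasSum.sub (hasSum_ite_eq 0 _)
    let V : Set (E.M .generic) := {z | p.app _ z ≠ 0}
    have hq : Function.Injective (fun z : V => p.app _ (z : E.M .generic)) := fun z z' hz =>
      Subtype.ext (h.normal _ _ _ z.2 hz)
    rw [← hq.hasSum_iff] at h1
    · have h2 : Function.Injective (fun z : V => (z : E.M .generic)) := Subtype.val_injective
      rw [← h2.hasSum_iff]
      · convert h1 using 1
        ext z
        have hz : p.app _ (z : E.M .generic) ≠ 0 := z.2
        have hz0 : (z : E.M .generic) ≠ 0 := fun h0 => hz (h0 ▸ p.map_zero _)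
        have hz1 : p.app _ (tpow j • (z : E.M .generic)) ≠ 0 := by
          rwa [p.map_smul, Ne, tpow_smul_eq_zero]
        simp only [B, Function.comp_apply, hz, hz0, if_false, eulerWeight, hcard2 _ _ hz,
          hcard2 _ _ hz1, p.map_smul, sub_zero]
      · intro z hz
        by_contra h3
        refine hz ⟨⟨z, fun h4 => h3 (if_pos h4)⟩, rfl⟩
    · intro z hz
      have hz0 : z = 0 := by
        by_contra h0
        obtain ⟨z, rfl⟩ := h.surj _ z
        exact hz ⟨⟨z, h0⟩, rfl⟩
      subst hz0
      simp [eulerWeight]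
  rw [hAB]
  convert hA.add hB using 1
  ring

/-- The nonzero generic elements of `E` are those of `D` together with lifts of those of `G`, and
stabilizers are unchanged: injectivity of `i` gives this on `D`, normality of `p` on the rest. -/
theorem HasCycles.add (h : IsShortExact i p) {c d : ℕ+ →₀ ℤ} (hD : D.HasCycles c)
    (hG : G.HasCycles d) : E.HasCycles (c + d) := by
  intro m
  let L : Set (E.M .generic) := {z | p.app _ z ≠ 0 ∧ z ∈ E.cycles m}
  have h1 : E.cycles m = i.app _ '' D.cycles m ∪ L := by
    have hi : ∀ z, i.app _ z ∈ E.cycles m ↔ z ∈ D.cycles m := fun z => by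
      simp only [GluingData.cycles, Set.mem_ofPred_eq, Ne, Hom.app_eq_zero (h.inj _), ← i.map_smul,
        (h.inj _).eq_iff]
    ext z
    by_cases hz : p.app _ z = 0
    · obtain ⟨n, rfl⟩ := (h.exact _ z).1 hz
      rw [hi, Set.mem_union, (h.inj _).mem_set_image]
      exact ⟨Or.inl, fun h1 => h1.elim id fun h2 => absurd hz h2.1⟩
    · refine ⟨fun h1 => Or.inr ⟨hz, h1⟩, fun h1 => h1.elim ?_ fun h2 => h2.2⟩
      rintro ⟨n, -, rfl⟩
      exact absurd (h.comp_eq_zero _ _) hz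
  have hL : Set.InjOn (p.app _) L := h.injOn _ fun _ hz => hz.1
  have h2 : p.app _ '' L = G.cycles m := by
    have hp : ∀ z : E.M .generic, p.app _ z ≠ 0 → ∀ k, tpow k • p.app _ z = p.app _ z ↔ tpow k • z = z := by
      intro z hz k
      rw [← p.map_smul]
      exact ⟨fun h3 => h.normal _ _ _ (h3 ▸ hz) h3, fun h3 => by rw [h3]⟩
    ext z
    constructor
    · rintro ⟨z, ⟨h0, h3⟩, rfl⟩
      exact ⟨h0, fun k => (hp z h0 k).trans (h3.2 k)⟩
    · rintro ⟨h0, h3⟩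
      obtain ⟨z, rfl⟩ := h.surj _ z
      exact ⟨z, ⟨h0, fun h4 => h0 (h4 ▸ p.map_zero _), fun k => (hp z h0 k).symm.trans (h3 k)⟩, rfl⟩
  have hLf : L.Finite := (h2 ▸ (hG m).1 : (p.app _ '' L).Finite).of_finite_image hL
  refine ⟨h1 ▸ ((hD m).1.image _).union hLf, ?_⟩
  rw [h1, Set.ncard_union_eq _ ((hD m).1.image _) hLf, Set.ncard_image_of_injective _ (h.inj _),
    ← hL.ncard_image, h2, Nat.cast_add, (hD m).2, (hG m).2, Finsupp.add_apply, mul_add]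
  rw [Set.disjoint_left]
  rintro _ ⟨n, -, rfl⟩ hn
  exact hn.1 (h.comp_eq_zero _ _)

theorem HasInvariants.add (h : IsShortExact i p) {a b : ℤ × ℤ × (ℕ+ →₀ ℤ)}
    (hD : D.HasInvariants a) (hG : G.HasInvariants b) : E.HasInvariants (a + b) where
  euler j := by
    convert (hD.euler j).add h (hG.euler j) using 1
    simp only [Prod.snd_add, Prod.fst_add, map_add]
    ring
  cycles := hD.cycles.add h hG.cycles

end Additivity

theorem hasInvariants_zero {D : GluingData} (h : ∀ x (m : D.M x), m = 0) :
    D.HasInvariants 0 := by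
  have hf : ∀ x z, D.fiber x z = ∅ := fun x z =>
    Set.eq_empty_of_forall_notMem fun m hm => hm.1 (h _ m)
  refine ⟨fun j => ⟨fun x z => by rw [hf]; exact Set.finite_empty, ?_⟩, fun m => ?_⟩
  · have h1 : D.eulerWeight j = fun _ => 0 := by
      ext z
      rw [eulerWeight, hf, hf, if_pos (h _ z), Set.ncard_empty, Set.ncard_empty]
      rfl
    rw [h1]
    simp
  · have h1 : D.cycles m = ∅ := Set.eq_empty_of_forall_notMem fun z hz => hz.1 (h _ z)
    rw [h1]
    simp

/-- Invariants are preserved by isomorphisms. -/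
theorem HasInvariants.of_bijective {D E : GluingData} (i : Hom D E)
    (hi : ∀ x, Function.Bijective (i.app x)) {a : ℤ × ℤ × (ℕ+ →₀ ℤ)} (hD : D.HasInvariants a) :
    E.HasInvariants a := by
  have h0 : ∀ x (m : i.coker.M x), m = 0 := by
    intro x m
    obtain ⟨m, rfl⟩ := Hom.toCoker_surjective x m
    exact Hom.toCoker_eq_zero.2 ((hi x).2 m)
  -- An isomorphism is a short exact sequence with zero cokernel, so additivity applies.
  have h1 := hD.add (Hom.isShortExact_coker fun x => (hi x).1) (hasInvariants_zero h0)
  rwa [add_zero] at h1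

end GluingData

/-! ## Invariants of the indecomposable sheaves and exact sequences between them -/

theorem TorMod.ncard_ne_zero (n : ℕ) :
    {m : TorMod n | m ≠ 0}.Finite ∧ {m : TorMod n | m ≠ 0}.ncard = n := by
  have h : {m : TorMod n | m ≠ 0} = (some : Fin n → Option (Fin n)) '' Set.univ := by
    ext m
    rcases m with _ | m
    · exact iff_of_false (fun h => h rfl) (by rintro ⟨_, _, h⟩; cases h)
    · exact iff_of_true (Option.some_ne_none m) ⟨m, trivial, rfl⟩
  rw [h]
  refine ⟨Set.finite_univ.image _, ?_⟩
  refine (Set.ncard_image_of_injective _ (Option.some_injective _)).trans ?_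
  rw [Set.ncard_univ, Nat.card_fin]

/-- All nonzero elements lie over the only generic element `0`, so every twist has the total length
as its Euler characteristic. -/
theorem hasInvariants_torsionData (l : ClosedPt → ℕ) :
    (torsionData l).HasInvariants (0, ((l .zero + l .infty : ℕ) : ℤ), 0) := by
  have hf : ∀ x z, (torsionData l).fiber x z = {m : TorMod (l x) | m ≠ 0} := fun x z =>
    Set.ext fun m => and_iff_left rfl
  have hcard : ∀ x z, ((torsionData l).fiber x z).ncard = l x := fun x z =>
    (congrArg Set.ncard (hf x z)).trans (TorMod.ncard_ne_zero _).2
  have : Unique ((torsionData l).M .generic) := inferInstanceAs (Unique PUnit)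
  refine ⟨fun j => ⟨fun x z => ?_, ?_⟩, fun m => ?_⟩
  · rw [hf]
    exact (TorMod.ncard_ne_zero _).1
  · convert hasSum_unique ((torsionData l).eulerWeight j) using 1
    rw [show (default : (torsionData l).M .generic) = 0 from rfl, eulerWeight_zero, hcard, hcard]
    simp
  · have h1 : (torsionData l).cycles m = ∅ :=
      Set.eq_empty_of_forall_notMem fun z hz => hz.1 rfl
    rw [h1]
    simp

theorem cyclicData_fiber_of_ne_zero {m : ℕ} (x : ClosedPt) {z : CycMod m} (hz : z ≠ 0) :
    (cyclicData m).fiber x z = ({z} : Set (CycMod m)) := by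
  ext w
  exact ⟨fun h => h.2, fun h => ⟨fun h0 => hz (Eq.trans (Eq.symm h) h0), h⟩⟩

theorem cyclicData_fiber_zero (m : ℕ) (x : ClosedPt) : (cyclicData m).fiber x 0 = ∅ :=
  Set.eq_empty_of_forall_notMem fun _ h => h.1 h.2

theorem cycMod_ncard (m : ℕ+) :
    {z : CycMod m | z ≠ 0}.Finite ∧ {z : CycMod m | z ≠ 0}.ncard = m := by
  have h : {z : CycMod m | z ≠ 0} =
      (fun w : Multiplicative (ZMod m) => (w : CycMod m)) '' Set.univ := by
    ext z
    induction z using WithZero.recZeroCoe with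
    | zero => exact iff_of_false (fun h => h rfl) (by rintro ⟨_, _, h⟩; cases h)
    | coe z => exact iff_of_true WithZero.coe_ne_zero ⟨z, trivial, rfl⟩
  have hfin : Finite (Multiplicative (ZMod m)) := inferInstanceAs (Finite (ZMod m))
  rw [h]
  refine ⟨Set.finite_univ.image _, ?_⟩
  rw [Set.ncard_image_of_injective _ WithZero.coe_injective, Set.ncard_univ]
  exact Nat.card_zmod m

/-- Each of the `m` nonzero elements has one lift at each closed point, hence weight `1 + 1 - 1`.
The sum `m` is accounted for by `cyclesSize`, leaving rank and degree zero. All `m` elements have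
stabilizer `mℤ`. -/
theorem hasInvariants_cyclicData (m : ℕ+) :
    (cyclicData m).HasInvariants (0, 0, Finsupp.single m 1) := by
  classical
  refine ⟨fun j => ⟨fun x (z : CycMod m) => ?_, ?_⟩, fun n => ?_⟩
  · by_cases hz : z = 0
    · rw [hz]
      exact (cyclicData_fiber_zero m x).symm ▸ Set.finite_empty
    · rw [cyclicData_fiber_of_ne_zero x hz]
      exact Set.finite_singleton _
  · have h1 : (cyclicData m).eulerWeight j =
        fun z : CycMod m => ({k ∈ {z : CycMod m | z ≠ 0} | id k = z}.ncard : ℤ) := by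
      funext (z : CycMod m)
      by_cases hz : z = 0
      · have h2 : {k ∈ {z : CycMod m | z ≠ 0} | id k = z} = ∅ :=
          Set.eq_empty_of_forall_notMem fun k hk => hk.1 (hk.2.trans hz)
        subst hz
        refine (eulerWeight_zero _ j).trans ?_
        rw [h2, Set.ncard_empty]
        exact congrArg₂ (fun a b : ℕ => (a + b : ℤ))
          ((congrArg Set.ncard (cyclicData_fiber_zero m _)).trans (Set.ncard_empty _))
          ((congrArg Set.ncard (cyclicData_fiber_zero m _)).trans (Set.ncard_empty _))
      · have h2 : {k ∈ {z : CycMod m | z ≠ 0} | id k = z} = {z} :=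
          Set.ext fun k => ⟨fun h => h.2, fun h => ⟨fun h0 => hz (Eq.trans (Eq.symm h) h0), h⟩⟩
        have h4 : ∀ x (w : CycMod m), w ≠ 0 → ((cyclicData m).fiber x w).ncard = 1 :=
          fun x w hw => (congrArg Set.ncard (cyclicData_fiber_of_ne_zero x hw)).trans
            (Set.ncard_singleton w)
        refine (eulerWeight_of_ne_zero j hz).trans ?_
        rw [h2, Set.ncard_singleton]
        exact congrArg₂ (fun a b : ℕ => (a + b - 1 : ℤ))
          (h4 .zero _ fun h3 => hz ((tpow_smul_eq_zero (M := (cyclicData m).M .generic)).1 h3)) (h4 .infty z hz)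
    have h3 := hasSum_ncard_fiber (cycMod_ncard m).1 (id : CycMod m → CycMod m)
    rw [(cycMod_ncard m).2] at h3
    have h4 : HasSum ((cyclicData m).eulerWeight j) ((m : ℕ) : ℤ) := by
      rw [h1]
      exact h3
    convert h4 using 1
    simp [cyclesSize]
  · have h1 : ∀ z : CycMod m, z ≠ 0 → ∀ k : ℤ,
        (cycHom m (tpow k) * z : CycMod m) = z ↔ ((m : ℕ) : ℤ) ∣ k := by
      intro z hz k
      have h2 := cycHom_tpow_eq_iff (m := m) (j := 0) (k := k)
      rw [sub_zero] at h2
      rw [← h2, mul_eq_right₀ hz, show tpow 0 = 1 from rfl, map_one, eq_comm]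
    have h2 : (cyclicData m).cycles n = {z : CycMod m | z ≠ 0 ∧ n = m} := by
      refine Set.ext fun z : CycMod m => ?_
      refine and_congr_right fun hz => ?_
      have h3 : (∀ k : ℤ, (cycHom m (tpow k) * z : CycMod m) = z ↔ ((n : ℕ) : ℤ) ∣ k) ↔ n = m := by
        simp only [h1 z hz]
        constructor
        · intro h
          have ha := (h m).1 dvd_rfl
          have hb := (h n).2 dvd_rfl
          exact PNat.eq (Nat.dvd_antisymm (Int.natCast_dvd_natCast.1 ha)
            (Int.natCast_dvd_natCast.1 hb))
        · rintro rfl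
          exact fun _ => Iff.rfl
      exact h3
    rw [h2]
    by_cases h : n = m
    · subst h
      simp only [and_true, Finsupp.single_eq_same, mul_one]
      exact ⟨(cycMod_ncard n).1, congrArg Nat.cast (cycMod_ncard n).2⟩
    · simp only [h, and_false, Finsupp.single_eq_of_ne h, mul_zero]
      exact ⟨Set.finite_empty, congrArg Nat.cast (Set.ncard_empty _)⟩

/-- For `s = -1` the two half-lines partition `ℤ` and every term vanishes. Raising `s` by one adds a
single `1`, at `i = -(s + 1)`. Induction runs in both directions from there. -/
theorem hasSum_line_weights (s : ℤ) : HasSum (fun i : ℤ => (if 0 ≤ i + s then (1 : ℤ) else 0) +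
    (if i ≤ 0 then 1 else 0) - 1) (s + 1) := by
  have key : ∀ s : ℤ, (fun i : ℤ => (if 0 ≤ i + (s + 1) then (1 : ℤ) else 0) +
      (if i ≤ 0 then 1 else 0) - 1) = fun i => ((if 0 ≤ i + s then (1 : ℤ) else 0) +
      (if i ≤ 0 then 1 else 0) - 1) + if i = -(s + 1) then 1 else 0 := by
    intro s
    funext i
    split_ifs <;> omega
  induction s using Int.inductionOn' (b := -1) with
  | zero =>
    have h0 : (fun i : ℤ => (if 0 ≤ i + -1 then (1 : ℤ) else 0) +
        (if i ≤ 0 then 1 else 0) - 1) = fun _ => 0 := by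
      funext i
      split_ifs <;> omega
    rw [h0]
    exact hasSum_zero
  | succ s _ ih =>
    rw [key]
    exact ih.add (hasSum_ite_eq _ 1)
  | pred s _ ih =>
    have h1 := key (s - 1)
    rw [sub_add_cancel] at h1
    rw [h1] at ih
    have h2 := ih.sub (hasSum_ite_eq (-s) 1)
    simp only [add_sub_cancel_right] at h2
    rwa [sub_add_cancel]

/-- The element over `t ^ (i + j)` at `0` exists iff `i + j + k ≥ 0`, the one over `t ^ i` at `∞`
iff `i ≤ 0`. The sum is `j + k + 1`, as in Riemann–Roch. The action on `η` is free, so there are no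
cycles. -/
theorem hasInvariants_lineBundleData (k : ℤ) : (lineBundleData k).HasInvariants (1, k, 0) := by
  classical
  have hsub : ∀ x z, ((lineBundleData k).fiber x z).Subsingleton := fun x z m hm m' hm' =>
    lineBundleData_gen_injective k _ (hm.2.trans hm'.2.symm)
  have hzero : ∀ x, (lineBundleData k).fiber x 0 = ∅ := fun x =>
    Set.eq_empty_of_forall_notMem fun m hm => hm.1 (lineBundleData_gen_injective k _
      (hm.2.trans ((lineBundleData k).gen_zero _).symm))
  have hcard : ∀ x z (P : Prop), (P ↔ ∃ n, (lineBundleData k).gen (.closed x) (upow x n) = z) →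
      z ≠ 0 → (((lineBundleData k).fiber x z).ncard : ℤ) = if P then 1 else 0 := by
    intro x z P hP hz
    split_ifs with h
    · obtain ⟨n, hn⟩ := hP.1 h
      have : (lineBundleData k).fiber x z = {upow x n} :=
        (hsub x z).eq_singleton_of_mem ⟨upow_ne_zero x n, hn⟩
      rw [this, Set.ncard_singleton, Nat.cast_one]
    · have : (lineBundleData k).fiber x z = ∅ := by
        refine Set.eq_empty_of_forall_notMem fun m hm => h (hP.2 ?_)
        rcases stalk_closed_cases (x := x) m with rfl | ⟨n, rfl⟩
        · exact absurd rfl hm.1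
        · exact ⟨n, hm.2⟩
      rw [this, Set.ncard_empty, Nat.cast_zero]
  refine ⟨fun j => ⟨fun x z => (hsub x z).finite, ?_⟩, fun m => ?_⟩
  · have h1 : HasSum ((lineBundleData k).eulerWeight j ∘ tpow) (j + k + 1) := by
      convert hasSum_line_weights (j + k) using 1
      funext i
      have hz : tpow j • tpow i = tpow (j + i) := rfl
      have hi : tpow i ≠ 0 := tpow_ne_zero i
      change (((lineBundleData k).fiber .zero (tpow j • tpow i)).ncard : ℤ) +
        ((lineBundleData k).fiber .infty (tpow i)).ncard - (if tpow i = 0 then 0 else 1) = _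
      rw [if_neg hi, hz, hcard .zero (tpow (j + i)) (0 ≤ i + (j + k)) ?_ (tpow_ne_zero _),
        hcard .infty (tpow i) (i ≤ 0) ?_ hi]
      rotate_left
      · constructor
        · intro h
          refine ⟨i.natAbs, ?_⟩
          change tpow (sgn .infty * (i.natAbs : ℤ)) = tpow i
          congr 1
          simp only [sgn]
          omega
        · rintro ⟨n, hn⟩
          have := tpow_injective hn
          simp [sgn] at this
          omega
      · constructor
        · intro h
          refine ⟨(i + (j + k)).toNat, ?_⟩
          change tpow (-k + sgn .zero * ((i + (j + k)).toNat : ℤ)) = tpow (j + i)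
          congr 1
          simp only [sgn]
          omega
        · rintro ⟨n, hn⟩
          have h2 : tpow (-k + sgn .zero * (n : ℤ)) = tpow (j + i) := hn
          have := tpow_injective h2
          simp only [sgn] at this
          omega
      · congr
    have h2 : HasSum ((lineBundleData k).eulerWeight j) (j + k + 1) := by
      refine (tpow_injective.hasSum_iff (f := (lineBundleData k).eulerWeight j) ?_).1 h1
      intro z hz
      rcases stalk_generic_cases z with rfl | ⟨i, rfl⟩
      · have h3 : tpow j • (0 : Stalk .generic) = 0 := mul_zero _
        change (((lineBundleData k).fiber .zero (tpow j • (0 : Stalk .generic))).ncard : ℤ) +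
          ((lineBundleData k).fiber .infty 0).ncard - (if (0 : Stalk .generic) = 0 then 0 else 1) = _
        rw [h3, hzero, hzero]
        simp
      · exact absurd ⟨i, rfl⟩ hz
    convert h2 using 1
    simp
    ring
  · have h1 : (lineBundleData k).cycles m = ∅ := by
      refine Set.eq_empty_of_forall_notMem ?_
      rintro z ⟨h0, hz⟩
      rcases stalk_generic_cases z with rfl | ⟨i, rfl⟩
      · exact h0 rfl
      · have h2 : tpow (((m : ℕ) : ℤ) + i) = tpow i := (hz m).2 dvd_rfl
        have := tpow_injective h2
        have := m.pos
        omega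
    rw [h1]
    simp

theorem Block.hasInvariants : ∀ b : Block, b.data.HasInvariants b.invariants
  | .line k => hasInvariants_lineBundleData k
  | .torsion x n => by
    have h := hasInvariants_torsionData (Pi.single x n)
    have h2 : (Pi.single x (n : ℕ) : ClosedPt → ℕ) .zero + (Pi.single x (n : ℕ) : ClosedPt → ℕ) .infty
        = n := by
      cases x <;> simp
    rw [h2] at h
    exact h
  | .cyclic m => hasInvariants_cyclicData m

theorem GluingData.IsGood.exists_hasInvariants (D : GluingData) (hD : D.IsGood) :
    ∃ a, D.HasInvariants a :=
  devissage (P := fun D _ => ∃ a, D.HasInvariants a) (fun _ _ h => ⟨0, hasInvariants_zero h⟩)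
    (fun b => ⟨_, b.hasInvariants⟩)
    (fun _ _ _ _ _ h ⟨a, ha⟩ ⟨b, hb⟩ => ⟨a + b, ha.add h hb⟩) D hD

/-- Torsion gluing data is an extension of torsion gluing data. -/
theorem exists_shortExact_torsionData (l l' : ClosedPt → ℕ) :
    ∃ (i : Hom (torsionData l) (torsionData (l + l')))
      (p : Hom (torsionData (l + l')) (torsionData l')), IsShortExact i p := by
  -- The subobject is generated by `u ^ l'`, whose annihilator starts at `u ^ l`; the quotient map
  -- sends the generator to the generator.
  have hi : ∀ y i, upow y i • (TorMod.mk ((l + l') y) (l' y)) = 0 ↔ l y ≤ i := fun y i => by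
    rw [TorMod.upow_smul, TorMod.mk_eq_zero, Pi.add_apply, Nat.add_le_add_iff_right]
  have hp : ∀ y, upow y ((l + l') y) • (TorMod.mk (l' y) 0) = 0 := fun y => by
    rw [TorMod.upow_smul, TorMod.mk_eq_zero]
    exact (Nat.le_add_left _ _).trans_eq (add_zero _).symm
  have hmk : ∀ y i, TorMod.lift (x := y) ((l + l') y) (TorMod.mk (l' y) 0)
      (TorMod.mk _ i) = TorMod.mk (l' y) i := fun y i => by
    rw [TorMod.lift_mk (hp y), TorMod.upow_smul, add_zero]
  refine ⟨torsionHom (D := torsionData (l + l')) (fun y => TorMod.mk ((l + l') y) (l' y))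
    fun y => (hi y _).2 le_rfl, torsionHom (D := torsionData l') (fun y => TorMod.mk (l' y) 0) hp,
    torsionHom_injective (torsionData_isGood _) _ hi, ?_, ?_, ?_⟩
  · rintro (y | _) m
    · change TorMod.lift (x := y) ((l + l') y) (TorMod.mk (l' y) 0) m = 0 ↔
        ∃ n : TorMod (l y), TorMod.lift (x := y) (l y) (TorMod.mk ((l + l') y) (l' y)) n = m
      rcases TorMod.cases m with rfl | ⟨i, hi', rfl⟩
      · exact iff_of_true rfl ⟨0, rfl⟩
      · rw [hmk, TorMod.mk_eq_zero]
        constructor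
        · intro h
          refine ⟨TorMod.mk _ (i - l' y), ?_⟩
          rw [TorMod.lift_mk ((hi y _).2 le_rfl), TorMod.upow_smul]
          congr 1
          omega
        · rintro ⟨n, hn⟩
          rcases TorMod.cases n with rfl | ⟨j, -, rfl⟩
          · rw [TorMod.lift_zero, eq_comm, TorMod.mk_eq_zero] at hn
            omega
          · rw [TorMod.lift_mk ((hi y _).2 le_rfl), TorMod.upow_smul] at hn
            have := TorMod.mk_inj hi' hn.symm
            omega
    · exact iff_of_true rfl ⟨PUnit.unit, rfl⟩
  · rintro (y | _) m m'
    · change TorMod.lift (x := y) ((l + l') y) (TorMod.mk (l' y) 0) m ≠ 0 →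
        TorMod.lift (x := y) ((l + l') y) (TorMod.mk (l' y) 0) m =
        TorMod.lift (x := y) ((l + l') y) (TorMod.mk (l' y) 0) m' → m = m'
      rcases TorMod.cases m with rfl | ⟨i, hi', rfl⟩
      · exact fun h => absurd rfl h
      · rw [hmk, Ne, TorMod.mk_eq_zero, not_le]
        intro h0 h
        rcases TorMod.cases m' with rfl | ⟨j, hj, rfl⟩
        · rw [TorMod.lift_zero, TorMod.mk_eq_zero] at h
          omega
        · rw [hmk] at h
          rw [TorMod.mk_inj h0 h]
    · exact fun h => absurd rfl h
  · rintro (y | _) m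
    · rcases TorMod.cases m with rfl | ⟨i, -, rfl⟩
      · exact ⟨0, rfl⟩
      · exact ⟨TorMod.mk _ i, hmk y i⟩
    · exact ⟨PUnit.unit, rfl⟩

/-- The quotient of a line bundle by a smaller line bundle is torsion. -/
theorem exists_shortExact_lineBundleData (k : ℤ) (l : ClosedPt → ℕ) :
    ∃ (i : Hom (lineBundleData k) (lineBundleData (k + l .zero + l .infty)))
      (p : Hom (lineBundleData (k + l .zero + l .infty)) (torsionData l)), IsShortExact i p := by
  set k' := k + l .zero + l .infty with hk'
  -- The embedding multiplies by `u ^ l` at each closed point. The two local maps glue because `-k'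
  -- + l 0 = -k - l ∞`, which is what fixes `k'`.
  have h : (lineBundleData k').gen (.closed .zero) (upow .zero (l .zero)) =
      tpow (-k) • (lineBundleData k').gen (.closed .infty) (upow .infty (l .infty)) := by
    change tpow (-k' + sgn .zero * (l .zero : ℤ)) = tpow (-k + sgn .infty * (l .infty : ℤ))
    congr 1
    simp only [sgn, hk']
    ring
  let i : Hom (lineBundleData k) (lineBundleData k') :=
    lineHom (D := lineBundleData k') (fun y => upow y (l y)) h
  let p : Hom (lineBundleData k') (torsionData l) :=
    { app := fun x => match x with
        | .closed y => fun a : Stalk (.closed y) => (a • TorMod.mk (l y) 0 : TorMod (l y))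
        | .generic => fun _ => PUnit.unit
      map_zero := fun x => by
        cases x with
        | closed y => exact zero_smul (Stalk (.closed y)) (TorMod.mk (l y) 0)
        | generic => rfl
      map_smul := fun x a m => by
        cases x with
        | closed y => exact mul_smul (α := Stalk (.closed y)) a m (TorMod.mk (l y) 0)
        | generic => rfl
      map_gen := fun _ _ => rfl }
  have hpu : ∀ y n, p.app (.closed y) (upow y n) = TorMod.mk (l y) n := fun y n =>
    (TorMod.upow_smul y n 0).trans (by rw [add_zero])
  refine ⟨i, p, lineHom_injective _ h ?_ ?_, ?_, ?_, ?_⟩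
  · exact tpow_ne_zero (sgn .infty * (l .infty : ℤ))
  · intro j hj
    have h1 : tpow (j + sgn .infty * (l .infty : ℤ)) = tpow (sgn .infty * (l .infty : ℤ)) := hj
    have := tpow_injective h1
    omega
  · rintro (y | _) m
    · rcases stalk_closed_cases (x := y) m with rfl | ⟨n, rfl⟩
      · exact iff_of_true (p.map_zero _) ⟨0, i.map_zero _⟩
      · rw [hpu]
        refine (TorMod.mk_eq_zero n).trans ⟨fun hn => ⟨upow y (n - l y), ?_⟩, ?_⟩
        · change upow y (n - l y + l y) = upow y n
          congr 1
          omega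
        · rintro ⟨b, hb⟩
          rcases stalk_closed_cases (x := y) b with rfl | ⟨j, rfl⟩
          · exact absurd ((i.map_zero _).symm.trans hb).symm (upow_ne_zero y n)
          · have h1 : upow y (j + l y) = upow y n := hb
            have := upow_injective y h1
            omega
    · refine iff_of_true rfl ?_
      change ∃ n : Stalk .generic, n * tpow (sgn .infty * (l .infty : ℤ)) = m
      obtain ⟨b, hb⟩ := (isUnit_tpow (sgn .infty * (l .infty : ℤ))).exists_left_inv
      exact ⟨m * b, by rw [mul_assoc, hb, mul_one]⟩
  · rintro (y | _) m m' h0 h1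
    · rcases stalk_closed_cases (x := y) m with rfl | ⟨n, rfl⟩
      · exact absurd (p.map_zero _) h0
      · rcases stalk_closed_cases (x := y) m' with rfl | ⟨n', rfl⟩
        · exact absurd (h1.trans (p.map_zero _)) h0
        · rw [hpu] at h0 h1
          rw [hpu] at h1
          have h2 : n < l y := by
            by_contra h3
            exact h0 (TorMod.mk_of_le (by omega))
          rw [TorMod.mk_inj h2 h1]
    · exact absurd rfl h0
  · rintro (y | _) m
    · rcases TorMod.cases m with rfl | ⟨n, -, rfl⟩
      · exact ⟨0, p.map_zero _⟩
      · exact ⟨upow y n, hpu y n⟩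
    · exact ⟨(0 : Stalk .generic), rfl⟩

/-! ## Normal coherent sheaves on the projective line and gluing data -/

/-- The smallest open neighbourhood of a point. -/
def nbd (x : Pt) : Opens Pt := ⟨{y | y = x ∨ y = .generic}, fun _ _ => Or.inr rfl⟩

theorem mem_nbd (x : Pt) : x ∈ nbd x := Or.inl rfl

theorem generic_mem_nbd (x : Pt) : Pt.generic ∈ nbd x := Or.inr rfl

theorem nbd_le {U : Opens Pt} {x : Pt} (h : x ∈ U) : nbd x ≤ U := by
  rintro y (rfl | rfl)
  · exact h
  · exact generic_mem h

theorem nbd_generic_le (x : Pt) : nbd .generic ≤ nbd x := nbd_le (generic_mem_nbd x)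

namespace GluingData

theorem nbd_ext {D : GluingData} {x : Pt} {s s' : D.Sec (nbd x)}
    (h : s.1 ⟨x, mem_nbd x⟩ = s'.1 ⟨x, mem_nbd x⟩) : s = s' := by
  refine Subtype.ext (funext ?_)
  rintro ⟨y, hy⟩
  rcases hy with rfl | rfl
  · exact h
  · have h1 := D.sec_generic s ⟨x, mem_nbd x⟩ (generic_mem_nbd x)
    have h2 := D.sec_generic s' ⟨x, mem_nbd x⟩ (generic_mem_nbd x)
    rw [h, ← h2] at h1
    exact h1

theorem sec_bot_eq {D : GluingData} (s s' : D.Sec ⊥) : s = s' :=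
  sec_subsingleton (fun _ hy => (Opens.mem_bot.1 hy : False)) s s'

theorem exists_section (D : GluingData) : ∀ (x : Pt) (m : D.M x),
    ∃ s : D.Sec (nbd x), s.1 ⟨x, mem_nbd x⟩ = m
  | .closed _, m => ⟨D.chartSec m, rfl⟩
  | .generic, m => by
    have h : ∀ y : nbd .generic, (y : Pt) = .generic := fun y => y.2.elim id id
    refine ⟨⟨fun y => cast (congrArg D.M (h y).symm) m, ?_⟩, rfl⟩
    rintro ⟨y, hy⟩ ⟨z, hz⟩
    obtain rfl : y = .generic := h ⟨y, hy⟩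
    obtain rfl : z = .generic := h ⟨z, hz⟩
    rfl

end GluingData

/-- Every section over the generic point is zero or a unit. So there is one prime ideal, and every
basic open set is either everything or empty. -/
theorem isAffineOpen_nbd_generic : P1.IsAffineOpen (nbd .generic) := by
  set g : nbd .generic := ⟨.generic, mem_nbd _⟩
  have hg : ∀ y : nbd .generic, y = g := fun y => Subtype.ext (y.2.elim id id)
  have hunit : ∀ f : P1Sec (nbd .generic), f = 0 ∨ IsUnit f := by
    intro f
    rcases stalk_generic_cases (f.1 g) with h | ⟨k, hk⟩
    · exact Or.inl (structureData.nbd_ext (x := .generic) h)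
    · refine Or.inr ((p1sec_isUnit f).2 fun y => ?_)
      rw [hg y, hk]
      exact isUnit_tpow k
  have h01 : ¬ IsUnit (0 : P1Sec (nbd .generic)) := fun h =>
    not_isUnit_zero (M₀ := Stalk .generic) ((p1sec_isUnit _).1 h g)
  have hz : ∀ y, y ∉ P1.basicOpen (U := nbd .generic) (0 : P1Sec (nbd .generic)) := by
    intro y hy
    exact not_isUnit_zero ((mem_basicOpen (U := nbd .generic) 0
      ⟨y, P1.basicOpen_le (U := nbd .generic) _ hy⟩).1 hy)
  have htop : ∀ f : P1Sec (nbd .generic), IsUnit f → nbd .generic ≤ P1.basicOpen (U := nbd .generic) f :=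
    fun f h => nbd_le ((mem_basicOpen f g).2 ((p1sec_isUnit f).1 h g))
  constructor
  · let p : PrimeIdeal (P1Sec (nbd .generic)) :=
      { carrier := {f | ¬ IsUnit f}
        zero_mem := h01
        mul_mem := fun a f hf h => hf (isUnit_of_mul_isUnit_right h)
        one_notMem := fun h => h isUnit_one
        mem_or_mem := fun a b h => by
          by_contra! h'
          exact h ((not_not.1 h'.1).mul (not_not.1 h'.2)) }
    have hp : ∀ q : PrimeIdeal (P1Sec (nbd .generic)), q = p := by
      intro q
      refine PrimeIdeal.ext (Set.ext fun f => ⟨fun hf hu => ?_, fun hf => ?_⟩)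
      · obtain ⟨b, hb⟩ := hu.exists_left_inv
        exact q.one_notMem (hb ▸ q.mul_mem b f hf)
      · rw [(hunit f).resolve_right hf]
        exact q.zero_mem
    have : Unique (PrimeIdeal (P1Sec (nbd .generic))) := ⟨⟨p⟩, hp⟩
    have : Unique (nbd .generic) := ⟨⟨g⟩, hg⟩
    refine ⟨Homeomorph.homeomorphOfUnique _ _, fun x f => ?_⟩
    rw [hp (Homeomorph.homeomorphOfUnique _ _ x)]
    refine not_not.trans (((p1sec_isUnit f).trans ?_).trans (mem_basicOpen f x).symm)
    exact ⟨fun h => h x, fun h y => by rwa [hg y, ← hg x]⟩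
  · intro (f : P1Sec (nbd .generic))
    refine ⟨?_, fun z => ?_, fun {m m'} hm => ?_⟩
    · rintro ⟨_, n, rfl⟩
      refine (p1sec_isUnit _).2 fun y => ?_
      have h2 := ((mem_basicOpen f ⟨y, P1.basicOpen_le f y.2⟩).1 y.2).pow n
      rw [← pow_val] at h2
      exact h2
    · rcases hunit f with rfl | hf
      · exact ⟨(0, 1), sec_subsingleton (D := structureData) hz _ _⟩
      · refine ⟨(P1.res (htop f hf) z, 1), ?_⟩
        exact (congrArg (z * ·) (map_one (P1.res (P1.basicOpen_le f)))).trans (mul_one z)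
    · rcases hunit f with rfl | hf
      · exact ⟨⟨0, 1, pow_one _⟩, (zero_mul m).trans (zero_mul m').symm⟩
      · refine ⟨1, congrArg _ ?_⟩
        exact congrArg (P1.res (htop f hf)) hm

theorem isAffineOpen_nbd : ∀ x : Pt, P1.IsAffineOpen (nbd x)
  | .closed x => isAffineOpen_chart x
  | .generic => isAffineOpen_nbd_generic

/-- The closed point of a nonempty affine open has no smaller neighbourhood, by
`exists_closed_point`. This reduces every condition on affine opens to stalks. -/
theorem eq_nbd_of_isAffineOpen {U : Opens Pt} (hU : P1.IsAffineOpen U) :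
    U = ⊥ ∨ ∃ x, U = nbd x := by
  by_cases hne : ∃ y, y ∈ U
  · obtain ⟨y, hy⟩ := hne
    have h01 : (1 : P1.O U) ≠ 0 := fun h1 =>
      one_ne_zero (α := Stalk y) (congrFun (congrArg Subtype.val h1) ⟨y, hy⟩)
    obtain ⟨x, hx⟩ := exists_closed_point hU h01
    exact Or.inr ⟨x, le_antisymm (hx _ (mem_nbd _)) (nbd_le x.2)⟩
  · exact Or.inl (eq_bot_iff.2 fun y hy => absurd ⟨y, hy⟩ hne)

/-- Uniqueness of gluing for the empty family. -/
theorem OModule.subsingleton_sec_bot {X : MonoidalSpace} (F : OModule X) :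
    Subsingleton (F.sec ⊥) := by
  have h : Subsingleton (F.sec (iSup (Empty.elim : Empty → Opens X.carrier))) := by
    obtain ⟨t, -, ht⟩ := F.glue (Empty.elim : Empty → Opens X.carrier) (fun i => i.elim)
      fun i => i.elim
    exact ⟨fun a b => (ht a fun i => i.elim).trans (ht b fun i => i.elim).symm⟩
  rwa [iSup_of_empty] at h

/-- A property of affine opens of the projective line which holds for the empty set holds for all
affine opens if it holds for the smallest neighbourhoods of the points. -/
theorem forall_affine {P : Opens Pt → Prop} (h0 : P ⊥) (h : ∀ x, P (nbd x)) (U : Opens Pt)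
    (hU : P1.IsAffineOpen U) : P U := by
  rcases eq_nbd_of_isAffineOpen hU with rfl | ⟨x, rfl⟩
  · exact h0
  · exact h x

/-! ### The stalks of a sheaf -/

/-- The structure sheaf over the smallest neighbourhood of a point. -/
noncomputable def sectionEquiv (x : Pt) : P1Sec (nbd x) ≃* Stalk x :=
  MulEquiv.ofBijective
    ({ toFun := fun s => s.1 ⟨x, mem_nbd x⟩
       map_mul' := fun _ _ => rfl } : P1Sec (nbd x) →ₙ* Stalk x)
    ⟨fun _ _ h => structureData.nbd_ext h, fun m => structureData.exists_section x m⟩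

/-- The section over the smallest neighbourhood of a point with a given germ. -/
noncomputable def ofStalk (x : Pt) : Stalk x →*₀ P1Sec (nbd x) where
  toFun := (sectionEquiv x).symm
  map_zero' := (MulEquiv.symm_apply_eq _).2 rfl
  map_one' := map_one _
  map_mul' := map_mul _

theorem ofStalk_val (x : Pt) (a : Stalk x) : (ofStalk x a).1 ⟨x, mem_nbd x⟩ = a :=
  (sectionEquiv x).apply_symm_apply a

theorem ofStalk_germ (x : Pt) (f : P1Sec (nbd x)) : ofStalk x (f.1 ⟨x, mem_nbd x⟩) = f :=
  (sectionEquiv x).symm_apply_apply f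

theorem res_ofStalk (x : Pt) (a : Stalk x) :
    P1.res (nbd_generic_le x) (ofStalk x a) = ofStalk .generic (genO x a) := by
  refine structureData.nbd_ext (x := .generic) ?_
  refine Eq.trans ?_ (ofStalk_val .generic (genO x a)).symm
  have h := (ofStalk x a).2 ⟨.generic, generic_mem_nbd x⟩ ⟨x, mem_nbd x⟩
  rw [ofStalk_val] at h
  exact h

instance (F : OModule P1) (U : Opens Pt) : MulActionWithZero (P1Sec U) (F.sec U) := F.act U

/-- The stalks of a sheaf of modules on the projective line. -/
noncomputable def stalks (F : OModule P1) : GluingData where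
  M x := F.sec (nbd x)
  zero x := F.zero (nbd x)
  act x := MulActionWithZero.compHom (F.sec (nbd x)) (ofStalk x)
  gen x := F.res (nbd_generic_le x)
  gen_zero x := F.res_zero _
  gen_smul x a m := by
    refine (F.res_smul (nbd_generic_le x) (ofStalk x a) m).trans ?_
    rw [res_ofStalk]
    rfl
  gen_generic m := F.res_refl _ m

theorem basicOpen_upow (x : ClosedPt) (n : ℕ) (hn : n ≠ 0) :
    P1.basicOpen (U := chart x) (ofStalk (.closed x) (upow x n)) = nbd .generic := by
  have hv : (ofStalk (.closed x) (upow x n)).1 ⟨.closed x, mem_nbd _⟩ = upow x n := ofStalk_val _ _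
  refine le_antisymm (fun y hy => ?_) (nbd_le ?_)
  · have h := P1.basicOpen_le (U := chart x) _ hy
    rcases h with rfl | rfl
    · have h1 := (mem_basicOpen (U := chart x) (ofStalk (.closed x) (upow x n))
        ⟨.closed x, mem_nbd _⟩).1 hy
      exact absurd (isUnit_upow.1 (hv ▸ h1)) hn
    · exact mem_nbd _
  · refine (mem_basicOpen (U := chart x) (ofStalk (.closed x) (upow x n))
      ⟨.generic, generic_mem_nbd _⟩).2 ?_
    have h1 := (ofStalk (.closed x) (upow x n)).2 ⟨.generic, generic_mem_nbd _⟩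
      ⟨.closed x, mem_nbd _⟩
    rw [hv] at h1
    exact (show IsUnit (genO .generic _) from h1 ▸ isUnit_tpow (sgn x * n))

/-- The only affine neighbourhood of a closed point is its chart, so coherence applies to the chart
itself. The localization conditions are those for `f = u`, whose basic open set is the generic
point. -/
theorem stalks_isGood (F : CohN P1) : (stalks F.sheaf).IsGood := by
  have hcoh : ∀ x : ClosedPt, F.sheaf.IsTilde (nbd (.closed x)) ∧
      IsFGModule (P1Sec (nbd (.closed x))) (F.sheaf.sec (nbd (.closed x))) := by
    intro x
    obtain ⟨U, hxU, hU, hT, hfg⟩ := F.coherent (.closed x)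
    rcases eq_nbd_of_isAffineOpen hU with rfl | ⟨y, rfl⟩
    · exact absurd hxU (Set.notMem_empty _)
    · rcases hxU with h | h
      · subst h
        exact ⟨hT, hfg⟩
      · cases h
  have hloc : ∀ x : ClosedPt, (∀ s : F.sheaf.sec (nbd .generic), ∃ (n : ℕ) (m : F.sheaf.sec (nbd (.closed x))),
      P1.res (nbd_generic_le (.closed x)) (ofStalk (.closed x) (upow x n)) • s =
        F.sheaf.res (nbd_generic_le (.closed x)) m) ∧
      (∀ m m' : F.sheaf.sec (nbd (.closed x)), F.sheaf.res (nbd_generic_le (.closed x)) m =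
        F.sheaf.res (nbd_generic_le (.closed x)) m' →
        ∃ n : ℕ, ofStalk (.closed x) (upow x n) • m =
          ofStalk (.closed x) (upow x n) • m') := by
    intro x
    -- Transport along the equality of opens from `basicOpen_upow`; a variable `V` permits the
    -- substitution.
    have key : ∀ (f : P1Sec (nbd (.closed x))) (V : Opens Pt) (hV : V ≤ nbd (.closed x)) (hV' : V = nbd .generic),
        ((∀ s : F.sheaf.sec V, ∃ (n : ℕ) (m : F.sheaf.sec (nbd (.closed x))),
          P1.res hV (f ^ n) • s = F.sheaf.res hV m) ∧
        (∀ m m' : F.sheaf.sec (nbd (.closed x)), F.sheaf.res hV m = F.sheaf.res hV m' →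
          ∃ n : ℕ, f ^ n • m = f ^ n • m')) →
        ((∀ s : F.sheaf.sec (nbd .generic), ∃ (n : ℕ) (m : F.sheaf.sec (nbd (.closed x))),
          P1.res (nbd_generic_le (.closed x)) (f ^ n) • s =
            F.sheaf.res (nbd_generic_le (.closed x)) m) ∧
        (∀ m m' : F.sheaf.sec (nbd (.closed x)), F.sheaf.res (nbd_generic_le (.closed x)) m =
          F.sheaf.res (nbd_generic_le (.closed x)) m' →
          ∃ n : ℕ, f ^ n • m = f ^ n • m')) := by
      rintro f _ _ rfl h
      exact h
    have hpow : ∀ n, (ofStalk (.closed x) (upow x 1)) ^ n = ofStalk (.closed x) (upow x n) :=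
      fun n => by rw [← map_pow, upow_pow, one_mul]
    have h := key (ofStalk (.closed x) (upow x 1)) _ _ (basicOpen_upow x 1 one_ne_zero)
      ((hcoh x).1 (ofStalk (.closed x) (upow x 1)))
    refine ⟨fun s => ?_, fun m m' hm => ?_⟩
    · obtain ⟨n, m, hm⟩ := h.1 s
      exact ⟨n, m, hpow n ▸ hm⟩
    · obtain ⟨n, hn⟩ := h.2 m m' hm
      exact ⟨n, hpow n ▸ hn⟩
  refine ⟨fun x => ?_, fun x a => ?_, fun x e => ?_, fun x m m' h => ?_⟩
  · obtain ⟨S, hS⟩ := (hcoh x).2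
    refine ⟨S, fun m => ?_⟩
    obtain ⟨a, g, hg, h⟩ := hS m
    exact ⟨a.1 ⟨.closed x, mem_nbd _⟩, g, hg, h.trans (congrArg (fun b : P1Sec _ =>
      (b • g : F.sheaf.sec (nbd (.closed x)))) (ofStalk_germ (.closed x) a).symm)⟩
  · exact F.normal (nbd x) (isAffineOpen_nbd x) (ofStalk x a)
  · obtain ⟨n, m, hm⟩ := (hloc x).1 e
    refine ⟨n, m, Eq.trans ?_ hm⟩
    rw [res_ofStalk]
    rfl
  · exact (hloc x).2 m m' h

/-- The map on stalks of a morphism of sheaves. -/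
noncomputable def stalksMap {F G : CohN P1} (φ : F ⟶ G) : Hom (stalks F.sheaf) (stalks G.sheaf) where
  app x := CohN.app φ (nbd x)
  map_zero x := (show CohN.Hom F G from φ).map_zero (nbd x)
  map_smul x a m := (show CohN.Hom F G from φ).map_smul (nbd x) (ofStalk x a) m
  map_gen x m := ((show CohN.Hom F G from φ).naturality (nbd_generic_le x) m).symm

theorem normal_app {F G : CohN P1} (φ : F ⟶ G) (x : Pt) : IsNormalMap (CohN.app φ (nbd x)) :=
  (show CohN.Hom F G from φ).normal (nbd x) (isAffineOpen_nbd x)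

/-- A normal map with trivial kernel is injective. -/
theorem isShortExact_stalksMap {F F' F'' : CohN P1} {i : F ⟶ F'} {p : F' ⟶ F''}
    (h : CohN.IsShortExact i p) : IsShortExact (stalksMap i) (stalksMap p) where
  inj x := by
    intro (m : F.sheaf.sec (nbd x)) m' hm
    have h1 := (h (nbd x) (isAffineOpen_nbd x)).1
    by_cases h0 : CohN.app i (nbd x) m = 0
    · exact (h1 m h0).trans (h1 m' (Eq.trans (Eq.symm hm) h0)).symm
    · exact (normal_app i x).2 m m' h0 hm
  exact x := (h (nbd x) (isAffineOpen_nbd x)).2.1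
  normal x := (normal_app p x).2
  surj x := (h (nbd x) (isAffineOpen_nbd x)).2.2

/-- Gluing data are isomorphic to the stalks of the glued sheaf. -/
theorem exists_bijective_stalks {D : GluingData} (hD : D.IsGood) :
    ∃ i : Hom D (stalks (D.toCohN hD).sheaf), ∀ x, Function.Bijective (i.app x) := by
  choose s hs using D.exists_section
  refine ⟨
    { app := s
      map_zero := fun x => nbd_ext (hs x 0)
      map_smul := fun x a m => nbd_ext ?_
      map_gen := fun x m => nbd_ext (x := .generic) ?_ }, fun x => ⟨fun m m' h => ?_, fun r => ?_⟩⟩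
  · refine (hs x _).trans ?_
    change a • m = (ofStalk x a).1 ⟨x, mem_nbd x⟩ • (s x m).1 ⟨x, mem_nbd x⟩
    rw [hs, ofStalk_val]
  · refine (hs .generic _).trans ?_
    have h1 := D.sec_generic (s x m) ⟨x, mem_nbd x⟩ (generic_mem_nbd x)
    rw [hs] at h1
    exact h1.symm
  · exact (hs x m).symm.trans ((congrArg (fun r : D.Sec (nbd x) => r.1 ⟨x, mem_nbd x⟩) h).trans
      (hs x m'))
  · exact ⟨r.1 ⟨x, mem_nbd x⟩, nbd_ext (hs x _)⟩

/-! ### Morphisms of glued sheaves -/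

/-- The morphism of glued sheaves given by a morphism of gluing data. -/
def gluedMap {D E : GluingData} (i : Hom D E) : OModule.Hom D.glued E.glued where
  app U s := ⟨fun x => i.app x (s.1 x), fun x y => by
    rw [← i.map_gen, ← i.map_gen, s.2 x y]⟩
  map_zero U := Subtype.ext (funext fun _ => i.map_zero _)
  map_smul U a s := Subtype.ext (funext fun _ => i.map_smul _ _ _)
  naturality _ _ := rfl

/-- The morphism of normal coherent sheaves given by a normal morphism of gluing data. -/
def toCohNMap {D E : GluingData} (hD : D.IsGood) (hE : E.IsGood) (i : Hom D E)
    (hi : ∀ x, IsNormalMap (i.app x)) : D.toCohN hD ⟶ E.toCohN hE :=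
  show CohN.Hom (D.toCohN hD) (E.toCohN hE) from
  { gluedMap i with
    normal := fun U hU => by
      refine ⟨(gluedMap i).map_zero U, ?_⟩
      revert U
      refine forall_affine (fun m m' _ _ => sec_bot_eq (D := D) m m')
        fun x m m' h0 h => ?_
      have h1 := congrArg (fun r : E.Sec (nbd x) => r.1 ⟨x, mem_nbd x⟩) h
      refine nbd_ext ((hi x).2 _ _ (fun h2 => h0 ?_) h1)
      exact nbd_ext h2 }

theorem isShortExact_toCohNMap {D E G : GluingData} (hD : D.IsGood) (hE : E.IsGood)
    (hG : G.IsGood) {i : Hom D E} {p : Hom E G} (h : IsShortExact i p)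
    (hi : ∀ x, IsNormalMap (i.app x)) (hp : ∀ x, IsNormalMap (p.app x)) :
    CohN.IsShortExact (toCohNMap hD hE i hi) (toCohNMap hE hG p hp) := by
  refine forall_affine ⟨fun s _ => sec_bot_eq (D := D) s 0,
    fun s => iff_of_true (sec_bot_eq (D := G) _ _)
      ⟨(0 : D.Sec ⊥), sec_bot_eq (D := E) _ _⟩,
    fun s => ⟨(0 : E.Sec ⊥), sec_bot_eq (D := G) _ _⟩⟩ fun x => ?_
  refine ⟨fun s hs => ?_, fun s => ⟨fun hs => ?_, ?_⟩, fun s => ?_⟩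
  · have h1 := congrArg (fun r : E.Sec (nbd x) => r.1 ⟨x, mem_nbd x⟩) hs
    exact nbd_ext ((Hom.app_eq_zero (h.inj x)).1 h1)
  · have h1 := congrArg (fun r : G.Sec (nbd x) => r.1 ⟨x, mem_nbd x⟩) hs
    obtain ⟨n, hn⟩ := (h.exact x _).1 h1
    obtain ⟨r, hr⟩ := D.exists_section x n
    exact ⟨r, nbd_ext ((congrArg (i.app x) hr).trans hn)⟩
  · rintro ⟨r, rfl⟩
    exact nbd_ext (h.comp_eq_zero x _)
  · obtain ⟨n, hn⟩ := h.surj x (s.1 ⟨x, mem_nbd x⟩)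
    obtain ⟨r, hr⟩ := E.exists_section x n
    exact ⟨r, nbd_ext ((congrArg (p.app x) hr).trans hn)⟩

/-- The morphism from a sheaf to the sheaf glued from its stalks. -/
noncomputable def toGluedStalks (F : CohN P1) : F ⟶ (stalks F.sheaf).toCohN (stalks_isGood F) :=
  show CohN.Hom F ((stalks F.sheaf).toCohN (stalks_isGood F)) from
  { app := fun U s => ⟨fun x => F.sheaf.res (nbd_le x.2) s, fun x y =>
      (F.sheaf.res_res _ _ _).trans (F.sheaf.res_res _ _ _).symm⟩
    map_zero := fun U => Subtype.ext (funext fun x => F.sheaf.res_zero _)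
    map_smul := fun U a s => Subtype.ext (funext fun x => by
      refine (F.sheaf.res_smul _ _ _).trans ?_
      refine congrArg (· • F.sheaf.res (nbd_le x.2) s) ?_
      exact (ofStalk_germ x.1 (P1.res (nbd_le x.2) a)).symm)
    naturality := fun h s => Subtype.ext (funext fun x => (F.sheaf.res_res _ _ _).symm)
    normal := fun U hU => by
      refine ⟨Subtype.ext (funext fun x => F.sheaf.res_zero _), ?_⟩
      revert U
      refine forall_affine (fun m m' _ _ => F.sheaf.subsingleton_sec_bot.elim m m')
        fun x m m' _ h => ?_
      have h1 := congrArg (fun r : (stalks F.sheaf).Sec (nbd x) => r.1 ⟨x, mem_nbd x⟩) h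
      exact (F.sheaf.res_refl _ m).symm.trans (h1.trans (F.sheaf.res_refl _ m')) }

/-- Affine opens suffice for the Grothendieck group, since exactness is tested only there; no
inverse morphism has to be built. -/
theorem toGluedStalks_bijective (F : CohN P1) : ∀ U, P1.IsAffineOpen U →
    Function.Bijective (CohN.app (toGluedStalks F) U) := by
  refine forall_affine ⟨fun m m' _ => F.sheaf.subsingleton_sec_bot.elim m m', fun s => ⟨0,
    sec_bot_eq (D := stalks F.sheaf) _ _⟩⟩ fun x => ⟨fun m m' h => ?_, fun s => ?_⟩
  · have h1 := congrArg (fun r : (stalks F.sheaf).Sec (nbd x) => r.1 ⟨x, mem_nbd x⟩) h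
    exact (F.sheaf.res_refl _ m).symm.trans (h1.trans (F.sheaf.res_refl _ m'))
  · exact ⟨s.1 ⟨x, mem_nbd x⟩, nbd_ext (F.sheaf.res_refl _ _)⟩

/-! ## The Grothendieck group of the projective line -/

theorem K0.cls_add {X : MonoidalSpace} {F F' F'' : CohN X} {i : F ⟶ F'} {p : F' ⟶ F''}
    (h : CohN.IsShortExact i p) : K0.cls F' = K0.cls F + K0.cls F'' := by
  have h1 : (QuotientAddGroup.mk (isoClass F + isoClass F'' - isoClass F') : K0 X) = 0 :=
    (QuotientAddGroup.eq_zero_iff _).2 (AddSubgroup.subset_closure ⟨F, F', F'', i, p, h, rfl⟩)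
  exact (sub_eq_zero.1 h1).symm

/-- For a zero sheaf the sequence `F → F → F` of identities is short exact, so `[F] = [F] + [F]`. -/
theorem K0.cls_eq_zero {X : MonoidalSpace} {F : CohN X}
    (h : ∀ U, X.IsAffineOpen U → ∀ s : F.sheaf.sec U, s = 0) : K0.cls F = 0 := by
  have h1 : CohN.IsShortExact (𝟙 F) (𝟙 F) := fun U hU =>
    ⟨fun s _ => h U hU s, fun s => iff_of_true (h U hU _) ⟨s, rfl⟩, fun s => ⟨s, rfl⟩⟩
  exact left_eq_add.1 (K0.cls_add h1)

theorem K0.cls_toCohN_zero {D : GluingData} (hD : D.IsGood) (h : ∀ x (m : D.M x), m = 0) :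
    K0.cls (D.toCohN hD) = 0 :=
  K0.cls_eq_zero fun _ _ _ => Subtype.ext (funext fun _ => h _ _)

theorem K0.cls_toCohN_add {D E G : GluingData} (hD : D.IsGood) (hE : E.IsGood) (hG : G.IsGood)
    {i : Hom D E} {p : Hom E G} (h : IsShortExact i p) :
    K0.cls (E.toCohN hE) = K0.cls (D.toCohN hD) + K0.cls (G.toCohN hG) :=
  K0.cls_add (isShortExact_toCohNMap hD hE hG h
    (fun x => ⟨i.map_zero x, fun _ _ _ h1 => h.inj x h1⟩)
    fun x => ⟨p.map_zero x, h.normal x⟩)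

/-- The comparison morphism followed by the map to the zero sheaf `torsionData 0` is a short exact
sequence. -/
theorem K0.cls_gluedStalks (F : CohN P1) :
    K0.cls F = K0.cls ((stalks F.sheaf).toCohN (stalks_isGood F)) := by
  have hZ : ∀ x (m : (torsionData 0).M x), m = 0 := by
    rintro (x | _) m
    · rcases TorMod.cases m with h | ⟨i, hi, -⟩
      · exact h
      · exact absurd hi (Nat.not_lt_zero i)
    · rfl
  let z : Hom (stalks F.sheaf) (torsionData 0) :=
    { app := fun _ _ => 0
      map_zero := fun _ => rfl
      map_smul := fun _ _ _ => (smul_zero _).symm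
      map_gen := fun _ _ => rfl }
  have hs : ∀ (U : Opens Pt) (s : (torsionData 0).Sec U), s = 0 := fun U s =>
    Subtype.ext (funext fun _ => hZ _ _)
  have h : CohN.IsShortExact (toGluedStalks F) (toCohNMap (stalks_isGood F) (torsionData_isGood 0) z
      fun x => ⟨rfl, fun _ _ h _ => absurd rfl h⟩) := fun U hU =>
    ⟨fun s h0 => (toGluedStalks_bijective F U hU).1
      (Eq.trans h0 ((show CohN.Hom _ _ from toGluedStalks F).map_zero U).symm),
      fun s => iff_of_true (hs U _) ((toGluedStalks_bijective F U hU).2 s),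
      fun s => ⟨(0 : (stalks F.sheaf).Sec U), (hs U _).trans (hs U s).symm⟩⟩
  rw [K0.cls_add h, K0.cls_toCohN_zero _ hZ, add_zero]

/-! ### The invariants as a homomorphism -/

/-- Rank, degree and cyclic multiplicities of a normal coherent sheaf. -/
noncomputable def CohN.invariants (F : CohN P1) : ℤ × ℤ × (ℕ+ →₀ ℤ) :=
  (IsGood.exists_hasInvariants _ (stalks_isGood F)).choose

theorem CohN.hasInvariants (F : CohN P1) : (stalks F.sheaf).HasInvariants F.invariants :=
  (IsGood.exists_hasInvariants _ (stalks_isGood F)).choose_spec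

theorem CohN.invariants_eq {F : CohN P1} {a : ℤ × ℤ × (ℕ+ →₀ ℤ)}
    (h : (stalks F.sheaf).HasInvariants a) : F.invariants = a := F.hasInvariants.unique h

theorem CohN.invariants_eq_of_iso {F G : CohN P1} (e : F ≅ G) : F.invariants = G.invariants := by
  refine (invariants_eq (F.hasInvariants.of_bijective (stalksMap e.hom) fun x => ?_)).symm
  have h1 : ∀ m, CohN.app e.inv (nbd x) (CohN.app e.hom (nbd x) m) = m := fun m =>
    congrArg (fun f : F ⟶ F => CohN.app f (nbd x) m) e.hom_inv_id
  have h2 : ∀ m, CohN.app e.hom (nbd x) (CohN.app e.inv (nbd x) m) = m := fun m =>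
    congrArg (fun f : G ⟶ G => CohN.app f (nbd x) m) e.inv_hom_id
  exact Function.bijective_iff_has_inverse.2 ⟨_, h1, h2⟩

/-- Rank, degree and cyclic multiplicities as a homomorphism on the Grothendieck group. -/
noncomputable def K0.invariants : K0 P1 →+ ℤ × ℤ × (ℕ+ →₀ ℤ) :=
  QuotientAddGroup.lift _ (FreeAbelianGroup.lift (Quotient.lift CohN.invariants
    fun _ _ ⟨e⟩ => CohN.invariants_eq_of_iso e)) (by
      rw [K0Relations, AddSubgroup.closure_le]
      rintro _ ⟨F, F', F'', i, p, h, rfl⟩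
      have h1 := CohN.invariants_eq
        (F.hasInvariants.add (isShortExact_stalksMap h) F''.hasInvariants)
      change FreeAbelianGroup.lift _ _ = 0
      rw [map_sub, map_add]
      simp only [isoClass, FreeAbelianGroup.lift_apply_of, Quotient.lift_mk]
      rw [h1, sub_self])

theorem K0.invariants_cls (F : CohN P1) : K0.invariants (K0.cls F) = F.invariants :=
  FreeAbelianGroup.lift_apply_of _ _

theorem K0.addHom_ext {X : MonoidalSpace} {A : Type*} [AddCommGroup A] {f g : K0 X →+ A}
    (h : ∀ F, f (K0.cls F) = g (K0.cls F)) : f = g := by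
  refine QuotientAddGroup.addMonoidHom_ext _ (FreeAbelianGroup.lift_ext _ _ ?_)
  rintro ⟨F⟩
  exact h F

theorem Block.exists_bijective_stalks (b : Block) :
    ∃ i : Hom b.data (stalks b.sheaf.sheaf), ∀ x, Function.Bijective (i.app x) := by
  rw [b.sheaf_eq]
  exact MonSch.exists_bijective_stalks b.isGood

theorem Block.invariants_sheaf (b : Block) : b.sheaf.invariants = b.invariants := by
  obtain ⟨i, hi⟩ := b.exists_bijective_stalks
  exact CohN.invariants_eq (b.hasInvariants.of_bijective i hi)

/-! ### Direct sums -/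

/-- Composition of morphisms of gluing data. -/
def GluingData.Hom.comp {D E G : GluingData} (i : Hom D E) (p : Hom E G) : Hom D G where
  app x m := p.app x (i.app x m)
  map_zero x := by rw [i.map_zero, p.map_zero]
  map_smul x a m := by rw [i.map_smul, p.map_smul]
  map_gen x m := by rw [i.map_gen, p.map_gen]

/-- Induction on the number of summands: the cokernel of one summand is the wedge of the others, and
additivity applies. -/
theorem GluingData.hasInvariants_directSum {J : Type} [Fintype J] (b : J → Block) (D : GluingData)
    (i : ∀ j, Hom (b j).data D) (hinj : ∀ j x, Function.Injective ((i j).app x))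
    (hdisj : ∀ j k, j ≠ k → ∀ x r r', (i j).app x r = (i k).app x r' → (i j).app x r = 0)
    (hcov : ∀ x m, m = 0 ∨ ∃ j r, (i j).app x r = m) :
    D.HasInvariants (∑ j, (b j).invariants) := by
  revert b D
  refine Fintype.induction_empty_option (P := fun J _ => ∀ (b : J → Block) (D : GluingData)
    (i : ∀ j, Hom (b j).data D), (∀ j x, Function.Injective ((i j).app x)) →
    (∀ j k, j ≠ k → ∀ x r r', (i j).app x r = (i k).app x r' → (i j).app x r = 0) →
    (∀ x m, m = 0 ∨ ∃ j r, (i j).app x r = m) → D.HasInvariants (∑ j, (b j).invariants))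
    ?_ ?_ ?_ J
  · intro α β _ e ih b D i hinj hdisj hcov
    let := Fintype.ofEquiv β e.symm
    rw [← e.sum_comp]
    refine ih (fun j => b (e j)) D (fun j => i (e j)) (fun j => hinj _)
      (fun j k hjk => hdisj _ _ (e.injective.ne hjk)) fun x m => (hcov x m).imp id ?_
    rintro ⟨j, r, h⟩
    obtain ⟨j, rfl⟩ := e.surjective j
    exact ⟨j, r, h⟩
  · intro b D i _ _ hcov
    rw [Finset.univ_eq_empty, Finset.sum_empty]
    exact hasInvariants_zero fun x m => (hcov x m).resolve_right fun ⟨j, _⟩ => j.elim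
  · intro J _ ih b D i hinj hdisj hcov
    rw [Fintype.sum_option]
    -- Distinct summands meet only in `0`, so nothing nonzero in another summand is collapsed.
    have hzero : ∀ j x r, (i none).toCoker.app x ((i (some j)).app x r) = 0 → r = 0 := by
      intro j x r h
      obtain ⟨n, hn⟩ := Hom.toCoker_eq_zero.1 h
      exact (Hom.app_eq_zero (hinj _ x)).1 (hdisj (some j) none (by simp) x r n hn.symm)
    refine (b none).hasInvariants.add (Hom.isShortExact_coker (hinj none))
      (ih (fun j => b (some j)) _ (fun j => (i (some j)).comp (i none).toCoker) ?_ ?_ ?_)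
    · intro j x r r' h
      by_cases h0 : (i none).toCoker.app x ((i (some j)).app x r) = 0
      · rw [hzero j x r h0, hzero j x r' (Eq.trans (Eq.symm h) h0)]
      · exact hinj _ x (Hom.toCoker_normal h0 h)
    · intro j k hjk x r r' h
      by_contra h0
      have h1 := hdisj (some j) (some k) (fun h => hjk (Option.some_injective _ h)) x r r'
        (Hom.toCoker_normal h0 h)
      exact h0 ((congrArg _ h1).trans ((i none).toCoker.map_zero x))
    · intro x m
      obtain ⟨m, rfl⟩ := Hom.toCoker_surjective x m
      rcases hcov x m with rfl | ⟨_ | j, r, rfl⟩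
      · exact Or.inl ((i none).toCoker.map_zero x)
      · exact Or.inl (Hom.toCoker_eq_zero.2 ⟨r, rfl⟩)
      · exact Or.inr ⟨j, r, rfl⟩

theorem CohN.invariants_directSum {J : Type} [Fintype J] (b : J → Block) (F : CohN P1)
    (i : ∀ j, (b j).sheaf ⟶ F) (h : CohN.IsDirectSum (fun j => (b j).sheaf) F i) :
    F.invariants = ∑ j, (b j).invariants := by
  choose e he using fun j => (b j).exists_bijective_stalks
  have h' := fun x => h (nbd x) (isAffineOpen_nbd x)
  refine invariants_eq (hasInvariants_directSum b _ (fun j => (e j).comp (stalksMap (i j))) ?_ ?_ ?_)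
  · exact fun j x => ((h' x).1 j).comp (he j x).1
  · exact fun j k hjk x r r' hr => (h' x).2.1 j k hjk _ _ hr
  · intro x m
    refine ((h' x).2.2 m).imp id ?_
    rintro ⟨j, r, hr⟩
    obtain ⟨r, rfl⟩ := (he j x).2 r
    exact ⟨j, r, hr⟩

/-! ### The inverse homomorphism -/

/-- The class of a torsion sheaf. -/
noncomputable def torsionClass (l : ClosedPt → ℕ) : K0 P1 :=
  K0.cls ((torsionData l).toCohN (torsionData_isGood l))

theorem torsionClass_add (l l' : ClosedPt → ℕ) :
    torsionClass (l + l') = torsionClass l + torsionClass l' := by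
  obtain ⟨i, p, h⟩ := exists_shortExact_torsionData l l'
  exact K0.cls_toCohN_add _ _ _ h

theorem cls_lineBundle_add (k : ℤ) (l : ClosedPt → ℕ) :
    K0.cls (lineBundle (k + l .zero + l .infty)) = K0.cls (lineBundle k) + torsionClass l := by
  obtain ⟨i, p, h⟩ := exists_shortExact_lineBundleData k l
  exact K0.cls_toCohN_add (lineBundleData_isGood _) (lineBundleData_isGood _) _ h

/-- The line bundle `O(l 0 + l ∞)` contains `O(0)` with quotient the torsion sheaf of lengths `l`,
and also with quotient `T_{0, l 0 + l ∞}`. Comparing the two moves all torsion to the point `0`,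
where lengths add. -/
theorem torsionClass_eq (l : ClosedPt → ℕ) :
    torsionClass l = (l .zero + l .infty) • torsionClass (Pi.single .zero 1) := by
  have h1 : ∀ n : ℕ, torsionClass (Pi.single .zero n) = n • torsionClass (Pi.single .zero 1) := by
    intro n
    induction n with
    | zero =>
      have h := torsionClass_add (Pi.single .zero 0) (Pi.single .zero 0)
      rw [← Pi.single_add, add_zero] at h
      rw [zero_smul, left_eq_add.1 h]
    | succ n ih => rw [Pi.single_add, torsionClass_add, ih, succ_nsmul]
  have h2 := cls_lineBundle_add 0 l
  have h3 := cls_lineBundle_add 0 (Pi.single .zero (l .zero + l .infty))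
  rw [Pi.single_eq_same, Pi.single_eq_of_ne (by decide), Nat.cast_zero, add_zero, Nat.cast_add,
    ← add_assoc, h2] at h3
  rw [add_left_cancel h3, h1]

theorem cls_torsionSheaf (x : ClosedPt) (n : ℕ) :
    K0.cls (torsionSheaf x n) = n • K0.cls (torsionSheaf .zero 1) := by
  refine (torsionClass_eq (Pi.single x n)).trans ?_
  congr 1
  cases x <;> simp

theorem cls_lineBundle (k : ℤ) :
    K0.cls (lineBundle k) = K0.cls (lineBundle 0) + k • K0.cls (torsionSheaf .zero 1) := by
  have h : ∀ (j : ℤ) (n : ℕ), K0.cls (lineBundle (j + n)) =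
      K0.cls (lineBundle j) + n • K0.cls (torsionSheaf .zero 1) := by
    intro j n
    have h1 := cls_lineBundle_add j (Pi.single .zero n)
    rw [Pi.single_eq_same, Pi.single_eq_of_ne (by decide), Nat.cast_zero, add_zero] at h1
    rw [h1, ← cls_torsionSheaf]
    rfl
  rcases Int.eq_nat_or_neg k with ⟨n, rfl | rfl⟩
  · have h1 := h 0 n
    rwa [zero_add, ← natCast_zsmul] at h1
  -- For negative degree, start at `O(-n)` and climb to `O(0)`.
  · have h1 := h (-n) n
    rw [neg_add_cancel, ← natCast_zsmul] at h1
    rw [h1, neg_smul, add_neg_cancel_right]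

/-- The homomorphism to the Grothendieck group with given rank, degree and cyclic multiplicities. -/
noncomputable def K0.ofInvariants : ℤ × ℤ × (ℕ+ →₀ ℤ) →+ K0 P1 :=
  (zmultiplesHom _ (K0.cls (lineBundle 0))).coprod
    ((zmultiplesHom _ (K0.cls (torsionSheaf .zero 1))).coprod
      (Finsupp.liftAddHom fun m => zmultiplesHom _ (K0.cls (cyclicSheaf m))))

theorem K0.ofInvariants_apply (r d : ℤ) (c : ℕ+ →₀ ℤ) : K0.ofInvariants (r, d, c) =
    r • K0.cls (lineBundle 0) + (d • K0.cls (torsionSheaf .zero 1) +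
      c.sum fun m n => n • K0.cls (cyclicSheaf m)) := rfl

theorem K0.ofInvariants_block (b : Block) : K0.ofInvariants b.invariants = K0.cls b.sheaf := by
  cases b with
  | line k =>
    refine (K0.ofInvariants_apply 1 k 0).trans ?_
    rw [one_smul, Finsupp.sum_zero_index, add_zero]
    exact (cls_lineBundle k).symm
  | torsion x n =>
    refine (K0.ofInvariants_apply 0 n 0).trans ?_
    rw [zero_smul, Finsupp.sum_zero_index, add_zero, zero_add, natCast_zsmul]
    exact (cls_torsionSheaf x n).symm
  | cyclic m =>
    refine (K0.ofInvariants_apply 0 0 _).trans ?_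
    rw [zero_smul, zero_smul, zero_add, zero_add, Finsupp.sum_single_index (h := fun m (n : ℤ) => n • K0.cls (cyclicSheaf m)) (zero_smul _ _),
      one_smul]
    rfl

theorem K0.invariants_block (b : Block) : K0.invariants (K0.cls b.sheaf) = b.invariants := by
  rw [K0.invariants_cls, b.invariants_sheaf]

/-- The generation half: both sides are additive on exact sequences, so by devissage they need only
be compared on the indecomposable sheaves. -/
theorem K0.ofInvariants_comp_invariants :
    K0.ofInvariants.comp K0.invariants = AddMonoidHom.id (K0 P1) := by
  refine K0.addHom_ext fun F => ?_
  rw [K0.cls_gluedStalks]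
  refine devissage (P := fun D hD => K0.ofInvariants.comp K0.invariants (K0.cls (D.toCohN hD)) =
    AddMonoidHom.id _ (K0.cls (D.toCohN hD))) ?_ ?_ ?_ _ (stalks_isGood F)
  · intro D hD h
    rw [K0.cls_toCohN_zero hD h, map_zero, map_zero]
  · intro b
    rw [← b.sheaf_eq, AddMonoidHom.comp_apply, K0.invariants_block, K0.ofInvariants_block]
    rfl
  · intro D E G hD hE hG i p h h1 h2
    rw [K0.cls_toCohN_add hD hE hG h, map_add, h1, h2, map_add]

/-- Stated for arbitrary `f` because it serves twice: for the invariants themselves, and for a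
competing isomorphism in the uniqueness proof. -/
theorem K0.comp_ofInvariants {f : K0 P1 →+ ℤ × ℤ × (ℕ+ →₀ ℤ)}
    (h1 : f (K0.cls (lineBundle 0)) = (1, 0, 0))
    (h2 : f (K0.cls (torsionSheaf .zero 1)) = (0, 1, 0))
    (h3 : ∀ m, f (K0.cls (cyclicSheaf m)) = (0, 0, Finsupp.single m 1)) :
    f.comp K0.ofInvariants = AddMonoidHom.id _ := by
  ext1 ⟨r, d, c⟩
  have hc : (c.sum fun m n => n • ((0, 0, Finsupp.single m 1) : ℤ × ℤ × (ℕ+ →₀ ℤ))) =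
      (0, 0, c) := by
    induction c using Finsupp.induction_linear with
    | zero => rfl
    | add c c' hc hc' =>
      rw [Finsupp.sum_add_index' (h := fun m (n : ℤ) =>
        n • ((0, 0, Finsupp.single m 1) : ℤ × ℤ × (ℕ+ →₀ ℤ))) (fun _ => zero_smul _ _)
        (fun _ _ _ => add_smul _ _ _), hc, hc']
      simp
    | single m n => simp
  rw [AddMonoidHom.comp_apply, K0.ofInvariants_apply, map_add, map_add, map_zsmul, map_zsmul,
    map_finsuppSum]
  simp only [map_zsmul, h1, h2, h3]
  rw [hc]
  simp

end MonSch

/-! ### The isomorphism and its uniqueness. -/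

theorem mainTheorem4 :
    ∃! Φ : MonSch.K0 MonSch.P1 ≃+ ℤ × ℤ × (ℕ+ →₀ ℤ),
      (∀ k : ℤ, Φ (MonSch.K0.cls (MonSch.lineBundle k)) = (1, k, 0)) ∧
      (∀ (x : MonSch.ClosedPt) (n : ℕ+),
        Φ (MonSch.K0.cls (MonSch.torsionSheaf x n)) = (0, (n : ℤ), 0)) ∧
      (∀ m : ℕ+, Φ (MonSch.K0.cls (MonSch.cyclicSheaf m)) = (0, 0, Finsupp.single m 1)) ∧
      (∀ {J : Type} [Fintype J] (b : J → MonSch.Block) (F : MonSch.CohN MonSch.P1)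
        (i : ∀ j, (b j).sheaf ⟶ F), MonSch.CohN.IsDirectSum (fun j => (b j).sheaf) F i →
        Φ (MonSch.K0.cls F) = ∑ j, (b j).invariants) := by
  have hinv : MonSch.K0.invariants.comp MonSch.K0.ofInvariants = AddMonoidHom.id _ :=
    MonSch.K0.comp_ofInvariants (MonSch.K0.invariants_block (.line 0))
      (MonSch.K0.invariants_block (.torsion .zero 1))
      fun m => MonSch.K0.invariants_block (.cyclic m)
  refine ⟨AddMonoidHom.toAddEquiv _ _ MonSch.K0.ofInvariants_comp_invariants hinv,
    ⟨fun k => MonSch.K0.invariants_block (.line k),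
      fun x n => MonSch.K0.invariants_block (.torsion x n),
      fun m => MonSch.K0.invariants_block (.cyclic m), fun b F i h =>
        (MonSch.K0.invariants_cls F).trans (MonSch.CohN.invariants_directSum b F i h)⟩, ?_⟩
  rintro Ψ ⟨h1, h2, h3, -⟩
  -- The values on `O(0)`, `T_{0,1}` and the `C_m` make `Ψ` a left inverse of `K0.ofInvariants`; as
  -- `K0.invariants` is a right inverse of it, the two coincide.
  have h4 : Ψ.toAddMonoidHom.comp MonSch.K0.ofInvariants = AddMonoidHom.id _ :=
    MonSch.K0.comp_ofInvariants (h1 0) (h2 .zero 1) h3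
  ext1 z
  have h5 := DFunLike.congr_fun MonSch.K0.ofInvariants_comp_invariants z
  have h6 := DFunLike.congr_fun h4 (MonSch.K0.invariants z)
  change Ψ (MonSch.K0.ofInvariants (MonSch.K0.invariants z)) = MonSch.K0.invariants z at h6
  change MonSch.K0.ofInvariants (MonSch.K0.invariants z) = z at h5
  rw [h5] at h6
  exact h6
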